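/- There is an absolute constant $C_0>0$ with the following property. Let $X_1,X_2,\dots$ be independent real random variables with $\mathbb E X_i=0$, $\mathbb E|X_i|^3<\infty$, and densities $p_{X_i}$ that are absolutely continuous on every compact interval. Put $B_n:=\sum_{i=1}^n \operatorname{Var}(X_i)$ and assume: 1. $\lim_{n\to\infty} B_n=\infty$; 2. $\sum_{i=1}^n \mathbb E|X_i|^3=O(B_n)$ as $n\to\infty$; 3. there are a subsequence $X_{n_1},X_{n_2},\dots$ with $n_1<n_2<\cdots$, a $\lambda>0$ and an $s\in(0,\lambda/2)$ such that $$\liminf_{n\to\infty}\frac{\#\{m: n_m\le n\}}{n^{\lambda}}>0\qquad\text{and}\qquad \inf_m \frac{n_m^{\,s}}{\int_{\mathbb R}|p'_{X_{n_m}}(x)|\,dx}>0$$ (in particular each $\int_{\mathbb R}|p'_{X_{n_m}}|$ is finite; the $\liminf$ may be $+\infty$). Then for every $n\ge1$ the normalized sum $B_n^{-1/2}\sum_{i=1}^n X_i$ has a density $p_n$, and there are constants $C_1,C_2>0$ (depending on the sequence, but not on $n$) such that $$\|p_n-\phi\|_\infty\le C_0B_n^{-3/2}\sum_{i=1}^n\mathbb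 E|X_i|^3+C_1\sqrt{B_n}\,e^{-C_2n^{\lambda-2s}}$$ for every $n\ge1$ such that $n\ge n_1$ or $p_n$ is essentially bounded, where $\phi(x)=(2\pi)^{-1/2}e^{-x^2/2}$ and $\|\cdot\|_\infty$ is the $L^\infty(\mathbb R)$ norm. If moreover $\lim_{n\to\infty}B_n/n^{\alpha}=0$ for some $\alpha>0$, then there is a constant $C>0$, not depending on $n$, such that for the same $n$ $$\|p_n-\phi\|_\infty\le C\,B_n^{-3/2}\sum_{i=1}^n\mathbb E|X_i|^3 .$$ -/

import Mathlib

open MeasureTheory ProbabilityTheory Filter Topology Asymptotics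
open scoped ENNReal

noncomputable section

/-- The random variable `X` has the density `p`, and `p` is absolutely continuous
(on every compact interval). -/
structure HasACDensity {Ω : Type*} [MeasurableSpace Ω] (P : Measure Ω) (X : Ω → ℝ)
    (p : ℝ → ℝ) : Prop where
  nonneg : ∀ x, 0 ≤ p x
  map_eq : P.map X = volume.withDensity (fun x => ENNReal.ofReal (p x))
  absCont : ∀ a b : ℝ, AbsolutelyContinuousOnInterval p a b

/-- `B_n`, the sum of the variances of the first `n` variables. -/
def varSum {Ω : Type*} [MeasurableSpace Ω] (P : Measure Ω) (X : ℕ → Ω → ℝ) (n : ℕ) : ℝ :=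
  ∑ i ∈ Finset.range n, variance (X i) P

/-- The sum of the absolute third moments of the first `n` variables. -/
def thirdMomentSum {Ω : Type*} [MeasurableSpace Ω] (P : Measure Ω) (X : ℕ → Ω → ℝ) (n : ℕ) : ℝ :=
  ∑ i ∈ Finset.range n, ∫ ω, |X i ω| ^ 3 ∂P

/-- The normalized sum of the first `n` variables: their sum divided by `√B_n`. -/
def normalizedSum {Ω : Type*} [MeasurableSpace Ω] (P : Measure Ω) (X : ℕ → Ω → ℝ) (n : ℕ) :
    Ω → ℝ :=
  fun ω => (∑ i ∈ Finset.range n, X i ω) / √(varSum P X n)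

/-- The density `p_n` of the normalized sum, as a real-valued function
(well defined up to null sets). -/
def sumDensity {Ω : Type*} [MeasurableSpace Ω] (P : Measure Ω) (X : ℕ → Ω → ℝ) (n : ℕ) :
    ℝ → ℝ :=
  fun x => (pdf (normalizedSum P X n) P volume x).toReal

/-- `‖p_n - φ‖_∞`, where `φ` is the standard normal density. -/
def densityDist {Ω : Type*} [MeasurableSpace Ω] (P : Measure Ω) (X : ℕ → Ω → ℝ) (n : ℕ) : ℝ≥0∞ :=
  eLpNorm (fun x => sumDensity P X n x - gaussianPDFReal 0 1 x) ∞ volume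

/-- `#{m : n_m ≤ n} / n^lam`. The variables are numbered from `0`, so the `(m+1)`-st member
of the subsequence is the variable with the one-based number `ν m + 1`. -/
def subseqDensity (ν : ℕ → ℕ) (lam : ℝ) (n : ℕ) : ℝ≥0∞ :=
  (Set.ncard {m : ℕ | ν m + 1 ≤ n} : ℝ≥0∞) / (n : ℝ≥0∞) ^ lam

end

/-!
The proof compares densities through characteristic functions. Write `B` for the variance, `S` for
the sum of the third absolute moments and `φ i` for the characteristic function of `X i`. As soon as
a summand with a density of finite total variation is present, the sum has a bounded continuous
density (`exists_continuous_density_sum`), so the Fourier inversion formula holds at every point and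
the uniform distance of this density from that of the normal law of variance `B` is at most
`∫ |∏ φ i (u) - exp (-B u² / 2)| du` (`abs_sub_le_integral_of_norm_charFun_sub_le`).

For `|u| ≤ B / (32 S)` the product is compared with the Gaussian factor by factor, using the Taylor
expansion of `φ i` to the third order and a telescoping sum (`norm_prod_sub_exp_le`). After
rescaling by `√B` this contributes an absolute multiple of the Lyapunov ratio `B ^ (-3 / 2) * S`.
The telescoping needs a small Lyapunov ratio. As `S = O(B)` and `B → ∞`, the ratio is small for all
large `n`, and the finitely many other `n` are absorbed in `C₁`.

The same hypothesis `S = O(B)` keeps `B / (32 S)` above a fixed `ε > 0`. For `|u| ≥ ε`, a density of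
total variation `V` satisfies `|φ(u)| ≤ 2 V / |u|` (`HasACDensity.norm_charFun_le_div`), and the
doubling inequality `1 - |φ(2u)| ≤ 4 (1 - |φ(u)|)` carries this bound from large `u` down to `ε`,
giving `|φ(u)| ≤ 1 - c / V²` (`norm_charFun_le_one_sub_of_le_div`). Two members of the subsequence
supply the integrable factor `1 / u²`. The others, at least a multiple of `n ^ lam` in number and
with `V` at most a multiple of `n ^ s`, supply the factor `exp (-C₂ n ^ (lam - 2 s))`
(`prod_norm_charFun_le`). Undoing the normalization costs the factor `√B`.

If `B` grows at most polynomially, then `B² exp (-C₂ n ^ (lam - 2 s))` is bounded while `S` is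
bounded below by `E|X 0|³ > 0`, so the exponential term is absorbed by the first one.
-/

/-! ### Absolutely continuous functions of bounded variation -/

theorem continuous_of_forall_absolutelyContinuousOnInterval {f : ℝ → ℝ}
    (hf : ∀ a b, AbsolutelyContinuousOnInterval f a b) : Continuous f := by
  refine continuous_iff_continuousAt.2 fun x => ?_
  refine (hf (x - 1) (x + 1)).continuousOn.continuousAt ?_
  rw [Set.uIcc_of_le (by linarith)]
  exact Icc_mem_nhds (by linarith) (by linarith)

theorem enorm_sub_le_setLIntegral_deriv {f : ℝ → ℝ} {a b : ℝ} (hab : a ≤ b)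
    (hf : AbsolutelyContinuousOnInterval f a b) :
    ‖f b - f a‖ₑ ≤ ∫⁻ x in Set.Ioc a b, ‖deriv f x‖ₑ := by
  rw [← hf.integral_deriv_eq_sub, intervalIntegral.integral_of_le hab]
  exact enorm_integral_le_lintegral_enorm _

theorem lintegral_enorm_translate_sub_le {f : ℝ → ℝ}
    (hf : ∀ a b, AbsolutelyContinuousOnInterval f a b) {h : ℝ} (hh : 0 ≤ h) :
    ∫⁻ x, ‖f (x + h) - f x‖ₑ ≤ ENNReal.ofReal h * ∫⁻ x, ‖deriv f x‖ₑ := by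
  have hm : Measurable fun x => ‖deriv f x‖ₑ := (measurable_deriv f).enorm
  calc ∫⁻ x, ‖f (x + h) - f x‖ₑ
      ≤ ∫⁻ x, ∫⁻ y in Set.Ioc 0 h, ‖deriv f (x + y)‖ₑ := by
        refine lintegral_mono fun x => ?_
        refine (enorm_sub_le_setLIntegral_deriv (by linarith) (hf x (x + h))).trans_eq ?_
        have := (measurePreserving_add_left volume x).setLIntegral_comp_preimage
          (measurableSet_Ioc (a := x) (b := x + h)) hm
        rw [← this]
        congr 2
        ext y
        simp
    _ = ∫⁻ y in Set.Ioc 0 h, ∫⁻ x, ‖deriv f (x + y)‖ₑ :=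
        lintegral_lintegral_swap
          (hm.comp (measurable_fst.add measurable_snd)).aemeasurable
    _ = ∫⁻ y in Set.Ioc 0 h, ∫⁻ x, ‖deriv f x‖ₑ := by
        congr 1 with y
        exact lintegral_add_right_eq_self (fun x => ‖deriv f x‖ₑ) y
    _ = ENNReal.ofReal h * ∫⁻ x, ‖deriv f x‖ₑ := by
        rw [lintegral_const, mul_comm]
        simp

theorem abs_sub_le_of_lintegral_deriv_le {f : ℝ → ℝ}
    (hf : ∀ a b, AbsolutelyContinuousOnInterval f a b) {V : ℝ} (hV : 0 ≤ V)
    (hfV : ∫⁻ x, ‖deriv f x‖ₑ ≤ ENNReal.ofReal V) (x y : ℝ) : |f x - f y| ≤ V := by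
  wlog hxy : y ≤ x generalizing x y
  · rw [abs_sub_comm]
    exact this y x (le_of_not_ge hxy)
  have h := ((enorm_sub_le_setLIntegral_deriv hxy (hf y x)).trans
    (setLIntegral_le_lintegral _ _)).trans hfV
  rw [Real.enorm_eq_ofReal_abs] at h
  exact (ENNReal.ofReal_le_ofReal_iff hV).1 h

namespace HasACDensity

variable {Ω : Type*} [MeasurableSpace Ω] {P : Measure Ω} {X : Ω → ℝ} {p : ℝ → ℝ}

theorem continuous (h : HasACDensity P X p) : Continuous p :=
  continuous_of_forall_absolutelyContinuousOnInterval h.absCont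

theorem lintegral_eq_one [IsProbabilityMeasure P] (h : HasACDensity P X p) (hX : Measurable X) :
    ∫⁻ x, ENNReal.ofReal (p x) = 1 := by
  have := Measure.isProbabilityMeasure_map (μ := P) hX.aemeasurable
  have h1 := measure_univ (μ := P.map X)
  rwa [h.map_eq, withDensity_apply _ MeasurableSet.univ, Measure.restrict_univ] at h1

theorem integrable [IsProbabilityMeasure P] (h : HasACDensity P X p) (hX : Measurable X) :
    Integrable p := by
  refine ⟨h.continuous.aestronglyMeasurable, ?_⟩
  rw [hasFiniteIntegral_iff_ofReal (ae_of_all _ h.nonneg), h.lintegral_eq_one hX]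
  exact ENNReal.one_lt_top

/-- A probability density of total variation at most `V` is bounded by `V + 1`: otherwise it
would exceed `1` everywhere. -/
theorem le_add_one [IsProbabilityMeasure P] (h : HasACDensity P X p) (hX : Measurable X)
    {V : ℝ} (hV : 0 ≤ V) (hpV : ∫⁻ x, ‖deriv p x‖ₑ ≤ ENNReal.ofReal V) (x : ℝ) :
    p x ≤ V + 1 := by
  by_contra! hx
  have hge : ∀ y, 1 ≤ p y := fun y => by
    have := (abs_le.1 (abs_sub_le_of_lintegral_deriv_le h.absCont hV hpV x y)).2
    linarith
  have h2 : ∫⁻ _ : ℝ, (1 : ℝ≥0∞) ≤ 1 :=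
    (lintegral_mono fun y => ENNReal.one_le_ofReal.2 (hge y)).trans_eq (h.lintegral_eq_one hX)
  simp at h2

end HasACDensity

/-! ### Decay of the characteristic function of a density of bounded variation -/

theorem charFun_withDensity_ofReal {p : ℝ → ℝ} (hp : Measurable p) (hp0 : ∀ x, 0 ≤ p x) (t : ℝ) :
    charFun (volume.withDensity fun x => ENNReal.ofReal (p x)) t
      = ∫ x, (p x : ℂ) * Complex.exp (t * x * Complex.I) := by
  rw [charFun_apply_real, integral_withDensity_eq_integral_toReal_smul hp.ennreal_ofReal
    (ae_of_all _ fun _ => ENNReal.ofReal_lt_top)]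
  simp [ENNReal.toReal_ofReal, hp0]

namespace HasACDensity

variable {Ω : Type*} [MeasurableSpace Ω] {P : Measure Ω} {X : Ω → ℝ} {p : ℝ → ℝ}

/-- Translating by `π / |u|` changes the sign of `exp (i u x)`, so twice the characteristic
function at `u` is the Fourier transform of a difference of translates of the density. -/
theorem norm_charFun_le_div [IsProbabilityMeasure P] (h : HasACDensity P X p) (hX : Measurable X)
    {V : ℝ} (hV : 0 ≤ V) (hpV : ∫⁻ x, ‖deriv p x‖ₑ ≤ ENNReal.ofReal V) {u : ℝ} (hu : u ≠ 0) :
    ‖charFun (P.map X) u‖ ≤ 2 * V / |u| := by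
  have hu' : 0 < |u| := abs_pos.2 hu
  set δ : ℝ := Real.pi / |u| with hδ
  have hδ0 : 0 ≤ δ := by positivity
  have hint : Integrable fun x => (p x : ℂ) * Complex.exp (u * x * Complex.I) := by
    refine (h.integrable hX).ofReal.mul_bdd (c := 1) ?_ (ae_of_all _ fun x => ?_)
    · fun_prop
    · rw [← Complex.ofReal_mul, Complex.norm_exp_ofReal_mul_I]
  have hsign : ∀ x : ℝ, Complex.exp (u * (x + δ : ℝ) * Complex.I)
      = - Complex.exp (u * x * Complex.I) := by
    intro x
    have huδ : u * δ = Real.pi ∨ u * δ = -Real.pi := by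
      rcases abs_choice u with hc | hc <;> rw [hδ, hc]
      · left; field_simp
      · right; field_simp
    have hsplit : (u * (x + δ : ℝ) * Complex.I : ℂ)
        = u * x * Complex.I + ((u * δ : ℝ) : ℂ) * Complex.I := by push_cast; ring
    rw [hsplit, Complex.exp_add]
    rcases huδ with hc | hc <;> rw [hc]
    · simp
    · simp [Complex.exp_neg]
  have hshift : charFun (P.map X) u
      = - ∫ x, (p (x + δ) : ℂ) * Complex.exp (u * x * Complex.I) := by
    rw [h.map_eq, charFun_withDensity_ofReal h.continuous.measurable h.nonneg,
      ← integral_add_right_eq_self _ δ, ← integral_neg]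
    refine integral_congr_ae (ae_of_all _ fun x => ?_)
    simp only [hsign, mul_neg]
  have hint' : Integrable fun x => (p (x + δ) : ℂ) * Complex.exp (u * x * Complex.I) := by
    refine (hint.comp_add_right δ).neg.congr (ae_of_all _ fun x => ?_)
    simp only [Pi.neg_apply, hsign, mul_neg, neg_neg]
  have htwo : 2 * charFun (P.map X) u
      = - ∫ x, ((p (x + δ) - p x : ℝ) : ℂ) * Complex.exp (u * x * Complex.I) := by
    have e1 : charFun (P.map X) u = ∫ x, (p x : ℂ) * Complex.exp (u * x * Complex.I) := by
      rw [h.map_eq, charFun_withDensity_ofReal h.continuous.measurable h.nonneg]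
    calc 2 * charFun (P.map X) u = charFun (P.map X) u + charFun (P.map X) u := two_mul _
      _ = (- ∫ x, (p (x + δ) : ℂ) * Complex.exp (u * x * Complex.I))
          + ∫ x, (p x : ℂ) * Complex.exp (u * x * Complex.I) := by rw [← hshift, ← e1]
      _ = - ∫ x, ((p (x + δ) - p x : ℝ) : ℂ) * Complex.exp (u * x * Complex.I) := by
        rw [neg_add_eq_sub, ← neg_sub, ← integral_sub hint' hint]
        congr 2 with x
        push_cast
        ring
  have hbound : ‖2 * charFun (P.map X) u‖ ≤ δ * V := by
    have : ‖2 * charFun (P.map X) u‖ₑ ≤ ENNReal.ofReal (δ * V) := by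
      rw [htwo, enorm_neg]
      refine (enorm_integral_le_lintegral_enorm _).trans ?_
      have hcongr : ∀ x, ‖((p (x + δ) - p x : ℝ) : ℂ) * Complex.exp (u * x * Complex.I)‖ₑ
          = ‖p (x + δ) - p x‖ₑ := by
        intro x
        rw [← ofReal_norm, ← ofReal_norm, norm_mul, ← Complex.ofReal_mul,
          Complex.norm_exp_ofReal_mul_I, mul_one, Complex.norm_real]
      simp_rw [hcongr]
      refine (lintegral_enorm_translate_sub_le h.absCont hδ0).trans ?_
      rw [ENNReal.ofReal_mul hδ0]
      gcongr
    rw [← ofReal_norm] at this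
    exact (ENNReal.ofReal_le_ofReal_iff (by positivity)).1 this
  rw [norm_mul, Complex.norm_ofNat] at hbound
  have hδV : δ * V ≤ 4 * V / |u| := by
    rw [hδ, div_mul_eq_mul_div]
    gcongr
    exact Real.pi_le_four
  have : 4 * V / |u| = 2 * (2 * V / |u|) := by ring
  linarith

end HasACDensity

/-- The doubling inequality for characteristic functions: if `|φ(u)| = ∫ cos (u x - θ)`, then
`|φ(2u)| ≥ ∫ cos (2 (u x - θ)) ≥ 2 |φ(u)|² - 1`. -/
theorem one_sub_norm_charFun_two_mul_le {μ : Measure ℝ} [IsProbabilityMeasure μ] (u : ℝ) :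
    1 - ‖charFun μ (2 * u)‖ ≤ 4 * (1 - ‖charFun μ u‖) := by
  set r := ‖charFun μ u‖ with hr
  set θ := (charFun μ u).arg with hθ
  have hr1 : r ≤ 1 := norm_charFun_le_one u
  have hr0 : 0 ≤ r := norm_nonneg _
  have key : ∀ s α : ℝ, (charFun μ s * Complex.exp (-α * Complex.I)).re
      = ∫ x, Real.cos (s * x - α) ∂μ := by
    intro s α
    rw [charFun_apply_real, ← integral_mul_const]
    have hfin : Integrable (fun x : ℝ => Complex.exp (s * x * Complex.I)
        * Complex.exp (-α * Complex.I)) μ := by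
      refine Integrable.of_bound (by fun_prop) 1 (ae_of_all _ fun x => ?_)
      rw [norm_mul, ← Complex.ofReal_mul, ← Complex.ofReal_neg, Complex.norm_exp_ofReal_mul_I,
        Complex.norm_exp_ofReal_mul_I, one_mul]
    have := integral_re hfin
    simp only [RCLike.re_eq_complex_re] at this
    rw [← this]
    refine integral_congr_ae (ae_of_all _ fun x => ?_)
    simp only
    rw [← Complex.exp_add, ← Complex.exp_ofReal_mul_I_re]
    congr 2
    push_cast
    ring
  have h1 : ∫ x, Real.cos (u * x - θ) ∂μ = r := by
    rw [← key]
    conv_lhs => rw [← Complex.norm_mul_exp_arg_mul_I (charFun μ u)]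
    rw [← hθ, mul_assoc, ← Complex.exp_add]
    simp [hr]
  have h2 : ∫ x, Real.cos (2 * (u * x - θ)) ∂μ ≤ ‖charFun μ (2 * u)‖ := by
    have e : ∀ x, 2 * (u * x - θ) = (2 * u) * x - 2 * θ := fun x => by ring
    simp_rw [e]
    rw [← key]
    refine (Complex.re_le_norm _).trans_eq ?_
    rw [norm_mul, ← Complex.ofReal_neg, Complex.norm_exp_ofReal_mul_I, mul_one]
  have hc : Integrable (fun x => Real.cos (u * x - θ)) μ :=
    Integrable.of_bound (by fun_prop) 1 (ae_of_all _ fun x => Real.abs_cos_le_one _)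
  have hc2 : Integrable (fun x => Real.cos (2 * (u * x - θ))) μ :=
    Integrable.of_bound (by fun_prop) 1 (ae_of_all _ fun x => Real.abs_cos_le_one _)
  have h3 : 2 * r ^ 2 - 1 ≤ ∫ x, Real.cos (2 * (u * x - θ)) ∂μ := by
    have hle : ∫ x, (4 * r * Real.cos (u * x - θ) - (2 * r ^ 2 + 1)) ∂μ
        ≤ ∫ x, Real.cos (2 * (u * x - θ)) ∂μ := by
      refine integral_mono ((hc.const_mul _).sub (integrable_const _)) hc2 fun x => ?_
      simp only [Real.cos_two_mul]
      nlinarith [sq_nonneg (Real.cos (u * x - θ) - r)]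
    rw [integral_sub (hc.const_mul _) (integrable_const _), integral_const_mul, h1] at hle
    simp at hle
    linarith
  nlinarith

theorem one_sub_norm_charFun_two_pow_mul_le {μ : Measure ℝ} [IsProbabilityMeasure μ] (u : ℝ)
    (k : ℕ) : 1 - ‖charFun μ (2 ^ k * u)‖ ≤ 4 ^ k * (1 - ‖charFun μ u‖) := by
  induction k with
  | zero => simp
  | succ k ih =>
    have := one_sub_norm_charFun_two_mul_le (μ := μ) (2 ^ k * u)
    rw [pow_succ' 2, mul_assoc, pow_succ' 4, mul_assoc]
    linarith

/-- A bound `|φ(u)| ≤ 2 W / |u|`, useful only for large `u`, is carried to all `u` with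
`|u| ≥ ε` by repeated doubling. -/
theorem norm_charFun_le_one_sub_of_le_div {μ : Measure ℝ} [IsProbabilityMeasure μ] {W ε : ℝ}
    (hW : 0 < W) (hε : 0 < ε) (hεW : ε ≤ 8 * W)
    (hdecay : ∀ u : ℝ, u ≠ 0 → ‖charFun μ u‖ ≤ 2 * W / |u|) {u : ℝ} (hu : ε ≤ |u|) :
    ‖charFun μ u‖ ≤ 1 - ε ^ 2 / (128 * W ^ 2) := by
  have hu0 : 0 < |u| := hε.trans_le hu
  have hhalf : ∀ w : ℝ, 4 * W ≤ |w| → ‖charFun μ w‖ ≤ 1 / 2 := by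
    intro w hw
    have hw0 : 0 < |w| := by linarith
    refine (hdecay w (abs_pos.1 hw0)).trans ?_
    rw [div_le_div_iff₀ hw0 two_pos]
    linarith
  by_cases hbig : 4 * W ≤ |u|
  · have := hhalf u hbig
    have h2 : ε ^ 2 / (128 * W ^ 2) ≤ 1 / 2 := by
      rw [div_le_div_iff₀ (by positivity) two_pos]
      nlinarith
    linarith
  push Not at hbig
  have hex : ∃ k : ℕ, 4 * W ≤ 2 ^ k * |u| := by
    obtain ⟨k, hk⟩ := pow_unbounded_of_one_lt (4 * W / |u|) (one_lt_two (α := ℝ))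
    exact ⟨k, by rw [div_lt_iff₀ hu0] at hk; exact hk.le⟩
  classical
  -- The least `k` that brings `2 ^ k * |u|` into the range of the decay bound.
  obtain ⟨k, hk, hmin⟩ : ∃ k : ℕ, 4 * W ≤ 2 ^ k * |u| ∧ 2 ^ k * |u| < 8 * W := by
    refine ⟨Nat.find hex, Nat.find_spec hex, ?_⟩
    obtain ⟨j, hj⟩ : ∃ j, Nat.find hex = j + 1 := by
      refine Nat.exists_eq_succ_of_ne_zero fun h0 => ?_
      have := Nat.find_spec hex
      rw [h0] at this
      linarith
    have := Nat.find_min hex (m := j) (by omega)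
    rw [hj, pow_succ]
    push Not at this
    linarith
  have hd := one_sub_norm_charFun_two_pow_mul_le (μ := μ) u k
  have h2 := hhalf (2 ^ k * u) (by rwa [abs_mul, abs_of_pos (by positivity : (0 : ℝ) < 2 ^ k)])
  have hN : (4 : ℝ) ^ k * ε ^ 2 ≤ 64 * W ^ 2 := by
    have e : (4 : ℝ) ^ k = (2 ^ k) ^ 2 := by rw [← pow_mul, mul_comm, pow_mul]; norm_num
    rw [e, ← mul_pow]
    calc (2 ^ k * ε) ^ 2 ≤ (8 * W) ^ 2 := by
          have : 2 ^ k * ε ≤ 2 ^ k * |u| := by gcongr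
          exact pow_le_pow_left₀ (by positivity) (this.trans hmin.le) 2
      _ = 64 * W ^ 2 := by ring
  have h4 : (0 : ℝ) < 4 ^ k := by positivity
  have hfin : ε ^ 2 / (128 * W ^ 2) ≤ 1 - ‖charFun μ u‖ := by
    rw [div_le_iff₀ (by positivity)]
    have h5 : 1 / 2 ≤ 4 ^ k * (1 - ‖charFun μ u‖) := by linarith
    have h6 : 0 ≤ 1 - ‖charFun μ u‖ := sub_nonneg.2 (norm_charFun_le_one u)
    have : (4 : ℝ) ^ k * ε ^ 2 ≤ 4 ^ k * ((1 - ‖charFun μ u‖) * (128 * W ^ 2)) := by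
      nlinarith [sq_nonneg W]
    exact le_of_mul_le_mul_left this h4
  linarith

/-! ### Comparison of characteristic functions near the origin -/

theorem norm_cexp_mul_I_sub_le (x : ℝ) :
    ‖Complex.exp (x * Complex.I) - (1 + x * Complex.I - x ^ 2 / 2)‖ ≤ 4 * |x| ^ 3 := by
  rcases le_total |x| 1 with hx | hx
  · have h := Complex.norm_exp_sub_sum_le_norm_mul_exp (x * Complex.I) 3
    have e : ∑ m ∈ Finset.range 3, (x * Complex.I) ^ m / (m.factorial : ℂ)
        = 1 + x * Complex.I - x ^ 2 / 2 := by
      simp [Finset.sum_range_succ, mul_pow]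
      ring
    rw [e, norm_mul, Complex.norm_I, mul_one, Complex.norm_real, Real.norm_eq_abs] at h
    have h1 : Real.exp |x| ≤ 4 := by
      have := Real.exp_le_exp.2 hx
      linarith [Real.exp_one_lt_d9]
    have h2 : 0 ≤ |x| ^ 3 := by positivity
    nlinarith
  · have h1 : ‖Complex.exp (x * Complex.I) - (1 + x * Complex.I - x ^ 2 / 2)‖
        ≤ 1 + (1 + |x| + |x| ^ 2 / 2) := by
      refine (norm_sub_le _ _).trans ?_
      rw [Complex.norm_exp_ofReal_mul_I]
      gcongr
      refine (norm_sub_le _ _).trans ?_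
      gcongr
      · refine (norm_add_le _ _).trans ?_
        simp
      · simp
    have h2 : |x| ≤ |x| ^ 3 := le_self_pow₀ hx (by norm_num)
    have h3 : |x| ^ 2 ≤ |x| ^ 3 := pow_le_pow_right₀ hx (by norm_num)
    linarith

theorem integrable_abs_pow_three {Ω : Type*} [MeasurableSpace Ω] {P : Measure Ω}
    {X : Ω → ℝ} (h3 : MemLp X 3 P) : Integrable (fun ω => |X ω| ^ 3) P := by
  have := h3.integrable_norm_pow (p := 3) (by norm_num)
  simpa using this

section ThirdMoment

variable {Ω : Type*} [MeasurableSpace Ω] {P : Measure Ω} [IsProbabilityMeasure P] {X : Ω → ℝ}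

theorem norm_charFun_map_sub_le (hX : Measurable X) (h3 : MemLp X 3 P) (h0 : ∫ ω, X ω ∂P = 0)
    (u : ℝ) : ‖charFun (P.map X) u - (1 - (variance X P * u ^ 2 / 2 : ℝ))‖
      ≤ 4 * (∫ ω, |X ω| ^ 3 ∂P) * |u| ^ 3 := by
  have hL1 : Integrable X P := h3.integrable (by norm_num)
  have hL2 : Integrable (fun ω => X ω ^ 2) P := (h3.mono_exponent (by norm_num)).integrable_sq
  have hvar : variance X P = ∫ ω, X ω ^ 2 ∂P := variance_of_integral_eq_zero hX.aemeasurable h0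
  have hexp : Integrable (fun ω => Complex.exp ((u * X ω : ℝ) * Complex.I)) P :=
    Integrable.of_bound (by fun_prop) 1
      (ae_of_all _ fun ω => (Complex.norm_exp_ofReal_mul_I _).le)
  have hL1c : Integrable (fun ω => ((u * X ω : ℝ) : ℂ)) P := (hL1.const_mul u).ofReal
  have hpoly1 : Integrable (fun ω => (1 : ℂ) + (u * X ω : ℝ) * Complex.I) P :=
    (integrable_const _).add (hL1c.mul_const _)
  have hpoly2 : Integrable (fun ω => (((u * X ω : ℝ) : ℂ)) ^ 2 / 2) P := by
    have : Integrable (fun ω => ((u ^ 2 / 2 * X ω ^ 2 : ℝ) : ℂ)) P := (hL2.const_mul _).ofReal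
    refine this.congr (ae_of_all _ fun ω => ?_)
    push_cast
    ring
  have e1 : charFun (P.map X) u = ∫ ω, Complex.exp ((u * X ω : ℝ) * Complex.I) ∂P := by
    rw [charFun_apply_real, integral_map hX.aemeasurable (by fun_prop)]
    simp
  have e2 : (1 - (variance X P * u ^ 2 / 2 : ℝ) : ℂ)
      = ∫ ω, ((1 : ℂ) + (u * X ω : ℝ) * Complex.I - ((u * X ω : ℝ) : ℂ) ^ 2 / 2) ∂P := by
    rw [integral_sub hpoly1 hpoly2, integral_add (integrable_const _)
      (hL1c.mul_const _), integral_mul_const, integral_complex_ofReal,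
      integral_const_mul, h0]
    have : ∀ ω, ((u * X ω : ℝ) : ℂ) ^ 2 / 2 = ((u ^ 2 / 2 * X ω ^ 2 : ℝ) : ℂ) := fun ω => by
      push_cast
      ring
    simp_rw [this]
    rw [integral_complex_ofReal, integral_const_mul, ← hvar]
    simp
    ring
  have e3 := integral_sub hexp (hpoly1.sub hpoly2)
  simp only [Pi.sub_apply] at e3
  rw [e1, e2, ← e3, mul_assoc, mul_comm _ (|u| ^ 3),
    ← integral_const_mul, ← integral_const_mul]
  refine norm_integral_le_of_norm_le
    (((integrable_abs_pow_three h3).const_mul _).const_mul _) (ae_of_all _ fun ω => ?_)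
  refine (norm_cexp_mul_I_sub_le _).trans_eq ?_
  rw [abs_mul, mul_pow]

/-- Lyapunov's inequality between the second and the third absolute moment. -/
theorem sqrt_variance_pow_three_le (hX : Measurable X) (h3 : MemLp X 3 P)
    (h0 : ∫ ω, X ω ∂P = 0) : √(variance X P) ^ 3 ≤ ∫ ω, |X ω| ^ 3 ∂P := by
  have hL2 : Integrable (fun ω => X ω ^ 2) P := (h3.mono_exponent (by norm_num)).integrable_sq
  have hvar : variance X P = ∫ ω, X ω ^ 2 ∂P := variance_of_integral_eq_zero hX.aemeasurable h0
  set σ := √(variance X P) with hσ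
  have hσ0 : 0 ≤ σ := Real.sqrt_nonneg _
  have hσ2 : ∫ ω, X ω ^ 2 ∂P = σ ^ 2 := by rw [← hvar, hσ, Real.sq_sqrt (variance_nonneg _ _)]
  -- The tangent at `σ` to the convex function `y ↦ y ^ (3 / 2)`, evaluated at `y = X ω ^ 2`.
  have h : ∫ ω, (3 / 2 * σ * X ω ^ 2 - σ ^ 3 / 2) ∂P ≤ ∫ ω, |X ω| ^ 3 ∂P := by
    refine integral_mono ((hL2.const_mul _).sub (integrable_const _))
      (integrable_abs_pow_three h3) fun ω => ?_
    have hy : 0 ≤ |X ω| := abs_nonneg _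
    simp only
    rw [← sq_abs (X ω)]
    nlinarith [mul_nonneg (sq_nonneg (|X ω| - σ)) (by positivity : 0 ≤ |X ω| + σ / 2)]
  rw [integral_sub (hL2.const_mul _) (integrable_const _), integral_const_mul, hσ2] at h
  simp at h
  nlinarith

end ThirdMoment

/-- The second-order Taylor bound, valid near the origin only, turned into an exponential bound
valid for all `x`. -/
theorem norm_le_exp_of_norm_sub_le {a : ℂ} {σ β x : ℝ} (hσ : 0 ≤ σ) (hx : 0 ≤ x)
    (ha1 : ‖a‖ ≤ 1) (ha : ‖a - (1 - (σ ^ 2 * x ^ 2 / 2 : ℝ))‖ ≤ 4 * β * x ^ 3)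
    (hβ : σ ^ 3 ≤ β) : ‖a‖ ≤ Real.exp (-(σ ^ 2 * x ^ 2 / 2) + 4 * β * x ^ 3) := by
  have hy3 : (σ * x) ^ 3 ≤ β * x ^ 3 := by rw [mul_pow]; gcongr
  have hy0 : 0 ≤ σ * x := by positivity
  rcases le_total (σ * x) 1 with hy | hy
  · have h1 : ‖((1 : ℂ) - (σ ^ 2 * x ^ 2 / 2 : ℝ))‖ = 1 - σ ^ 2 * x ^ 2 / 2 := by
      rw [← Complex.ofReal_one, ← Complex.ofReal_sub, Complex.norm_real, Real.norm_eq_abs,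
        abs_of_nonneg]
      nlinarith
    have h2 := norm_le_norm_add_norm_sub' a (1 - (σ ^ 2 * x ^ 2 / 2 : ℝ))
    rw [h1] at h2
    have h3 := Real.add_one_le_exp (-(σ ^ 2 * x ^ 2 / 2) + 4 * β * x ^ 3)
    linarith
  · -- Here the exponent is nonnegative, because `β x³ ≥ (σ x)³ ≥ (σ x)²`.
    refine ha1.trans (Real.one_le_exp ?_)
    have : (σ * x) ^ 2 ≤ (σ * x) ^ 3 := pow_le_pow_right₀ hy (by norm_num)
    nlinarith [sq_nonneg (σ * x)]

theorem abs_exp_neg_sub_le {y : ℝ} (hy : 0 ≤ y) :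
    |Real.exp (-(y ^ 2 / 2)) - (1 - y ^ 2 / 2)| ≤ y ^ 3 := by
  rcases le_total y 1 with h | h
  · have h1 := Real.abs_exp_sub_one_sub_id_le (x := -(y ^ 2 / 2))
      (by rw [abs_neg, abs_of_nonneg (by positivity)]; nlinarith)
    rw [show Real.exp (-(y ^ 2 / 2)) - 1 - -(y ^ 2 / 2)
      = Real.exp (-(y ^ 2 / 2)) - (1 - y ^ 2 / 2) by ring] at h1
    have h3 : 0 ≤ y ^ 3 := by positivity
    nlinarith
  · have h1 := Real.add_one_le_exp (-(y ^ 2 / 2))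
    have h2 : Real.exp (-(y ^ 2 / 2)) ≤ 1 := Real.exp_le_one_iff.2 (by nlinarith)
    have h3 : y ^ 2 ≤ y ^ 3 := pow_le_pow_right₀ h (by norm_num)
    rw [abs_of_nonneg (by linarith)]
    nlinarith [sq_nonneg y]

/-- Telescoping for products whose factors are dominated by common weights `E i`. The weights need
not be at most `1`, so the Gaussian decay of the other factors is kept. -/
theorem norm_prod_sub_prod_le_mul_sum {ι : Type*} (s : Finset ι) (a b : ι → ℂ) (E : ι → ℝ)
    (hE : ∀ i ∈ s, 0 < E i) (ha : ∀ i ∈ s, ‖a i‖ ≤ E i) (hb : ∀ i ∈ s, ‖b i‖ ≤ E i) :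
    ‖∏ i ∈ s, a i - ∏ i ∈ s, b i‖ ≤ (∏ i ∈ s, E i) * ∑ i ∈ s, ‖a i - b i‖ / E i := by
  classical
  induction s using Finset.induction_on with
  | empty => simp
  | insert i s his ih =>
    simp only [Finset.mem_insert, forall_eq_or_imp] at hE ha hb
    have ih' := ih hE.2 ha.2 hb.2
    rw [Finset.prod_insert his, Finset.prod_insert his, Finset.prod_insert his,
      Finset.sum_insert his]
    have hB : ‖∏ j ∈ s, b j‖ ≤ ∏ j ∈ s, E j := by
      rw [norm_prod]
      exact Finset.prod_le_prod (fun _ _ => norm_nonneg _) hb.2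
    have e : a i * ∏ j ∈ s, a j - b i * ∏ j ∈ s, b j
        = a i * (∏ j ∈ s, a j - ∏ j ∈ s, b j) + (a i - b i) * ∏ j ∈ s, b j := by ring
    have hEi := hE.1
    calc ‖a i * ∏ j ∈ s, a j - b i * ∏ j ∈ s, b j‖
        ≤ ‖a i‖ * ‖∏ j ∈ s, a j - ∏ j ∈ s, b j‖ + ‖a i - b i‖ * ‖∏ j ∈ s, b j‖ := by
          rw [e, ← norm_mul, ← norm_mul]
          exact norm_add_le _ _
      _ ≤ E i * ((∏ j ∈ s, E j) * ∑ j ∈ s, ‖a j - b j‖ / E j)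
          + ‖a i - b i‖ * ∏ j ∈ s, E j := by
          have := ha.1
          gcongr
      _ = E i * (∏ j ∈ s, E j) * (‖a i - b i‖ / E i + ∑ j ∈ s, ‖a j - b j‖ / E j) := by
          field_simp
          ring

/-- The comparison of a product of characteristic functions with the Gaussian one, stated for
complex numbers `a i` that have the Taylor expansion of characteristic functions at `±x`. The
factors omitted by the telescoping sum cost at most `exp (σ i ^ 2 * x ^ 2 / 2)`, which is harmless
because `σ i ≤ R / 2` when the Lyapunov ratio is small. -/
theorem norm_prod_sub_exp_le {ι : Type*} (s : Finset ι) (a : ι → ℂ) (σ β : ι → ℝ) {R x : ℝ}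
    (hR : 0 < R) (hx : 0 ≤ x) (hσ : ∀ i ∈ s, 0 ≤ σ i) (hβ : ∀ i ∈ s, σ i ^ 3 ≤ β i)
    (ha1 : ∀ i ∈ s, ‖a i‖ ≤ 1)
    (ha : ∀ i ∈ s, ‖a i - (1 - (σ i ^ 2 * x ^ 2 / 2 : ℝ))‖ ≤ 4 * β i * x ^ 3)
    (hRs : ∑ i ∈ s, σ i ^ 2 = R ^ 2) (hS : 8 * ∑ i ∈ s, β i ≤ R ^ 3)
    (hxS : 32 * (∑ i ∈ s, β i) * x ≤ R ^ 2) :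
    ‖∏ i ∈ s, a i - Real.exp (-(R ^ 2 * x ^ 2 / 2))‖
      ≤ 5 * (∑ i ∈ s, β i) * x ^ 3 * Real.exp (-(R ^ 2 * x ^ 2 / 4)) := by
  set S := ∑ i ∈ s, β i with hSdef
  have hβ0 : ∀ i ∈ s, 0 ≤ β i := fun i hi => (pow_nonneg (hσ i hi) 3).trans (hβ i hi)
  set E : ι → ℝ := fun i => Real.exp (-(σ i ^ 2 * x ^ 2 / 2) + 4 * β i * x ^ 3) with hE
  set b : ι → ℂ := fun i => (Real.exp (-(σ i ^ 2 * x ^ 2 / 2)) : ℝ) with hb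
  have hprodb : ∏ i ∈ s, b i = Real.exp (-(R ^ 2 * x ^ 2 / 2)) := by
    rw [hb, ← Complex.ofReal_prod, ← Real.exp_sum, Finset.sum_neg_distrib, ← Finset.sum_div,
      ← Finset.sum_mul, hRs]
  have hprodE : ∏ i ∈ s, E i = Real.exp (-(R ^ 2 * x ^ 2 / 2) + 4 * S * x ^ 3) := by
    rw [hE, ← Real.exp_sum, Finset.sum_add_distrib, Finset.sum_neg_distrib, ← Finset.sum_div,
      ← Finset.sum_mul, hRs, ← Finset.sum_mul, ← Finset.mul_sum]
  have hbE : ∀ i ∈ s, ‖b i‖ ≤ E i := by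
    intro i hi
    simp only [hb, hE, Complex.norm_real, Real.norm_eq_abs, Real.abs_exp]
    have := hβ0 i hi
    exact Real.exp_le_exp.2 (le_add_of_nonneg_right (by positivity))
  have haE : ∀ i ∈ s, ‖a i‖ ≤ E i := fun i hi =>
    norm_le_exp_of_norm_sub_le (hσ i hi) hx (ha1 i hi) (ha i hi) (hβ i hi)
  have hdiff : ∀ i ∈ s, ‖a i - b i‖ ≤ 5 * β i * x ^ 3 := by
    intro i hi
    have h1 : ‖((1 - (σ i ^ 2 * x ^ 2 / 2 : ℝ)) : ℂ) - b i‖ ≤ β i * x ^ 3 := by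
      have h2 := abs_exp_neg_sub_le (mul_nonneg (hσ i hi) hx)
      rw [abs_sub_comm, mul_pow, mul_pow] at h2
      rw [hb, ← Complex.ofReal_one, ← Complex.ofReal_sub, ← Complex.ofReal_sub,
        Complex.norm_real, Real.norm_eq_abs]
      exact h2.trans (mul_le_mul_of_nonneg_right (hβ i hi) (by positivity))
    have := norm_sub_le_norm_sub_add_norm_sub (a i) (1 - (σ i ^ 2 * x ^ 2 / 2 : ℝ)) (b i)
    linarith [ha i hi]
  have hσR : ∀ i ∈ s, σ i ≤ R / 2 := by
    intro i hi
    refine le_of_pow_le_pow_left₀ (n := 3) (by norm_num) (by positivity) ?_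
    have h1 : β i ≤ S := Finset.single_le_sum hβ0 hi
    have h2 := hβ i hi
    have : (R / 2) ^ 3 = R ^ 3 / 8 := by ring
    linarith
  have key := norm_prod_sub_prod_le_mul_sum s a b E (fun i _ => Real.exp_pos _) haE hbE
  rw [hprodb] at key
  refine key.trans ?_
  rw [Finset.mul_sum, hSdef, Finset.mul_sum, Finset.sum_mul, Finset.sum_mul]
  refine Finset.sum_le_sum fun i hi => ?_
  have hexp : (∏ j ∈ s, E j) / E i ≤ Real.exp (-(R ^ 2 * x ^ 2 / 4)) := by
    rw [hprodE, ← Real.exp_sub]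
    refine Real.exp_le_exp.2 ?_
    have h1 : 4 * S * x ^ 3 ≤ R ^ 2 * x ^ 2 / 8 := by nlinarith [sq_nonneg x]
    have h2 : σ i ^ 2 * x ^ 2 ≤ (R / 2) ^ 2 * x ^ 2 := by
      have := hσR i hi
      have := hσ i hi
      gcongr
    have h3 : 0 ≤ 4 * β i * x ^ 3 := by
      have := hβ0 i hi
      positivity
    nlinarith
  calc (∏ j ∈ s, E j) * (‖a i - b i‖ / E i) = ‖a i - b i‖ * ((∏ j ∈ s, E j) / E i) := by ring
    _ ≤ 5 * β i * x ^ 3 * Real.exp (-(R ^ 2 * x ^ 2 / 4)) := by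
      have h1 : 0 ≤ (∏ j ∈ s, E j) / E i :=
        div_nonneg (Finset.prod_nonneg fun j _ => (Real.exp_pos _).le) (Real.exp_pos _).le
      exact mul_le_mul (hdiff i hi) hexp h1 ((norm_nonneg _).trans (hdiff i hi))

/-! ### Convolution with a bounded continuous density -/

section Conv

variable {p : ℝ → ℝ} {ν : Measure ℝ} [IsProbabilityMeasure ν] {M : ℝ}

theorem integrable_translate (hp : Continuous p) (hp0 : ∀ x, 0 ≤ p x) (hpM : ∀ x, p x ≤ M)
    (x : ℝ) : Integrable (fun z => p (x - z)) ν := by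
  refine Integrable.of_bound (by fun_prop) M (ae_of_all _ fun z => ?_)
  rw [Real.norm_eq_abs, abs_of_nonneg (hp0 _)]
  exact hpM _

theorem continuous_integral_translate (hp : Continuous p) (hp0 : ∀ x, 0 ≤ p x)
    (hpM : ∀ x, p x ≤ M) : Continuous fun x => ∫ z, p (x - z) ∂ν := by
  refine continuous_of_dominated (bound := fun _ => M) (fun x => by fun_prop)
    (fun x => ae_of_all _ fun z => ?_) (integrable_const _) (ae_of_all _ fun z => by fun_prop)
  rw [Real.norm_eq_abs, abs_of_nonneg (hp0 _)]
  exact hpM _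

theorem integral_translate_le (hp : Continuous p) (hp0 : ∀ x, 0 ≤ p x) (hpM : ∀ x, p x ≤ M)
    (x : ℝ) : ∫ z, p (x - z) ∂ν ≤ M := by
  refine (integral_mono (integrable_translate hp hp0 hpM x) (integrable_const M)
    fun z => hpM _).trans_eq ?_
  simp

theorem withDensity_conv_eq (hp : Continuous p) (hp0 : ∀ x, 0 ≤ p x) (hpM : ∀ x, p x ≤ M) :
    (volume.withDensity fun x => ENNReal.ofReal (p x)) ∗ ν
      = volume.withDensity fun x => ENNReal.ofReal (∫ z, p (x - z) ∂ν) := by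
  have hpm : Measurable fun x => ENNReal.ofReal (p x) := hp.measurable.ennreal_ofReal
  refine Measure.ext_of_lintegral _ fun f hf => ?_
  have hfm : Measurable fun x => ∫⁻ z, f (x + z) ∂ν :=
    Measurable.lintegral_prod_right' (f := fun y : ℝ × ℝ => f (y.1 + y.2)) (by fun_prop)
  rw [Measure.lintegral_conv hf, lintegral_withDensity_eq_lintegral_mul _ hpm
    hfm,
    lintegral_withDensity_eq_lintegral_mul _
      (continuous_integral_translate hp hp0 hpM).measurable.ennreal_ofReal hf]
  have hm₁ : Measurable fun y : ℝ × ℝ => ENNReal.ofReal (p y.1) * f (y.1 + y.2) := by fun_prop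
  have hm₂ : Measurable fun y : ℝ × ℝ => ENNReal.ofReal (p (y.2 - y.1)) * f y.2 := by fun_prop
  calc ∫⁻ x, ENNReal.ofReal (p x) * ∫⁻ z, f (x + z) ∂ν
      = ∫⁻ x, ∫⁻ z, ENNReal.ofReal (p x) * f (x + z) ∂ν := by
        congr 1 with x
        rw [lintegral_const_mul _ (by fun_prop)]
    _ = ∫⁻ z, (∫⁻ x, ENNReal.ofReal (p x) * f (x + z)) ∂ν :=
        lintegral_lintegral_swap hm₁.aemeasurable
    _ = ∫⁻ z, (∫⁻ x, ENNReal.ofReal (p (x - z)) * f x) ∂ν := by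
        congr 1 with z
        rw [← lintegral_add_right_eq_self (fun x => ENNReal.ofReal (p (x - z)) * f x) z]
        simp
    _ = ∫⁻ x, ∫⁻ z, ENNReal.ofReal (p (x - z)) * f x ∂ν :=
        lintegral_lintegral_swap hm₂.aemeasurable
    _ = ∫⁻ x, ENNReal.ofReal (∫ z, p (x - z) ∂ν) * f x := by
        congr 1 with x
        rw [lintegral_mul_const _ (by fun_prop), ofReal_integral_eq_lintegral_ofReal
          (integrable_translate hp hp0 hpM x) (ae_of_all _ fun z => hp0 _)]

end Conv

/-! ### Comparison of densities through their characteristic functions -/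

/-- The supremum bound given by Fourier inversion. The factor `1 / (2 π)` of the inversion formula
in this normalization is dropped. -/
theorem abs_le_integral_of_norm_fourier_le {g G : ℝ → ℝ} (hg : Continuous g) (hgi : Integrable g)
    (hG : Integrable G)
    (hle : ∀ u : ℝ, ‖∫ x, (g x : ℂ) * Complex.exp (u * x * Complex.I)‖ ≤ G u) (x : ℝ) :
    |g x| ≤ ∫ u, G u := by
  set gc : ℝ → ℂ := fun x => (g x : ℂ) with hgc
  have hgci : Integrable gc := hgi.ofReal
  have hF : ∀ w : ℝ, ‖FourierTransform.fourier gc w‖ ≤ G (-2 * Real.pi * w) := by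
    intro w
    refine le_trans (le_of_eq ?_) (hle (-2 * Real.pi * w))
    rw [Real.fourier_eq']
    congr 2 with v
    rw [smul_eq_mul, mul_comm]
    congr 2
    simp
    ring
  have hGs : Integrable fun w : ℝ => G (-2 * Real.pi * w) :=
    hG.comp_mul_left' (by simp [Real.pi_ne_zero])
  have hFi : Integrable (FourierTransform.fourier gc) := by
    refine hGs.mono' ?_ (ae_of_all _ hF)
    exact (VectorFourier.fourierIntegral_continuous Real.continuous_fourierChar
      (innerSL ℝ).continuous₂ hgci).aestronglyMeasurable
  have hgcc : Continuous gc := Complex.continuous_ofReal.comp hg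
  have hinv := congrFun (hgcc.fourierInv_fourier_eq hgci hFi) x
  have hG0 : 0 ≤ ∫ u, G u := integral_nonneg fun u => (norm_nonneg _).trans (hle u)
  calc |g x| = ‖gc x‖ := by simp [hgc]
    _ = ‖FourierTransformInv.fourierInv (FourierTransform.fourier gc) x‖ := by
        rw [hinv]
    _ ≤ ∫ w : ℝ, G (-2 * Real.pi * w) := by
        rw [Real.fourierInv_eq']
        refine norm_integral_le_of_norm_le hGs (ae_of_all _ fun w => ?_)
        rw [norm_smul, Complex.norm_exp_ofReal_mul_I, one_mul]
        exact hF w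
    _ = |(-2 * Real.pi)⁻¹| * ∫ u, G u := by
        rw [Measure.integral_comp_mul_left, smul_eq_mul]
    _ ≤ 1 * ∫ u, G u := by
        gcongr
        rw [abs_inv, abs_mul, abs_neg, abs_of_pos Real.pi_pos, Nat.abs_ofNat]
        refine inv_le_one_of_one_le₀ ?_
        linarith [Real.pi_gt_three]
    _ = ∫ u, G u := one_mul _

theorem abs_sub_le_integral_of_norm_charFun_sub_le {q₁ q₂ G : ℝ → ℝ} (h₁ : Continuous q₁)
    (h₂ : Continuous q₂) (h₁i : Integrable q₁) (h₂i : Integrable q₂) (h₁0 : ∀ x, 0 ≤ q₁ x)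
    (h₂0 : ∀ x, 0 ≤ q₂ x) (hG : Integrable G)
    (hle : ∀ u : ℝ, ‖charFun (volume.withDensity fun x => ENNReal.ofReal (q₁ x)) u
      - charFun (volume.withDensity fun x => ENNReal.ofReal (q₂ x)) u‖ ≤ G u) (x : ℝ) :
    |q₁ x - q₂ x| ≤ ∫ u, G u := by
  refine abs_le_integral_of_norm_fourier_le (g := fun x => q₁ x - q₂ x) (h₁.sub h₂)
    (h₁i.sub h₂i) hG (fun u => ?_) x
  refine le_trans (le_of_eq ?_) (hle u)
  have hi : ∀ q : ℝ → ℝ, Integrable q →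
      Integrable fun x => (q x : ℂ) * Complex.exp (u * x * Complex.I) := fun q hq => by
    refine hq.ofReal.mul_bdd (c := 1) (by fun_prop) (ae_of_all _ fun x => ?_)
    rw [← Complex.ofReal_mul, Complex.norm_exp_ofReal_mul_I]
  rw [charFun_withDensity_ofReal h₁.measurable h₁0, charFun_withDensity_ofReal h₂.measurable h₂0,
    ← integral_sub (hi _ h₁i) (hi _ h₂i)]
  congr 2 with x
  push_cast
  ring

/-! ### Scaling of densities -/

theorem map_div_withDensity_ofReal {q : ℝ → ℝ} (hq : Measurable q) {R : ℝ} (hR : 0 < R) :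
    (volume.withDensity fun x => ENNReal.ofReal (q x)).map (fun x => x / R)
      = volume.withDensity fun x => ENNReal.ofReal (R * q (R * x)) := by
  have hqm : Measurable fun x => ENNReal.ofReal (q x) := hq.ennreal_ofReal
  refine Measure.ext_of_lintegral _ fun f hf => ?_
  rw [lintegral_map hf (by fun_prop), lintegral_withDensity_eq_lintegral_mul _ hqm (by fun_prop),
    lintegral_withDensity_eq_lintegral_mul _ (by fun_prop) hf]
  simp only [Pi.mul_apply]
  conv_lhs => rw [← Real.smul_map_volume_mul_left hR.ne']
  rw [lintegral_smul_measure, lintegral_map (by fun_prop) (by fun_prop), smul_eq_mul,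
    ← lintegral_const_mul _ (by fun_prop)]
  congr 1 with x
  rw [mul_div_cancel_left₀ _ hR.ne', abs_of_pos hR, ENNReal.ofReal_mul hR.le, mul_assoc]

theorem gaussianPDFReal_one_eq_sqrt_mul {B : ℝ} (hB : 0 < B) (x : ℝ) :
    gaussianPDFReal 0 1 x = √B * gaussianPDFReal 0 B.toNNReal (√B * x) := by
  have h : 0 < √B := Real.sqrt_pos.2 hB
  simp only [gaussianPDFReal, Real.coe_toNNReal _ hB.le, sub_zero, NNReal.coe_one, mul_one]
  rw [Real.sqrt_mul' _ hB.le, mul_pow, Real.sq_sqrt hB.le, mul_inv, ← mul_assoc]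
  congr 1
  · field_simp
  · congr 1
    field_simp

/-! ### Integrals that bound the distance of the densities -/

theorem integrable_abs_pow_mul_exp (k : ℕ) {b : ℝ} (hb : 0 < b) :
    Integrable fun x : ℝ => |x| ^ k * Real.exp (-(b * x ^ 2)) := by
  have h := (integrable_rpow_mul_exp_neg_mul_sq hb
    (by have := k.cast_nonneg (α := ℝ); linarith : (-1 : ℝ) < k)).norm
  refine h.congr (ae_of_all _ fun x => ?_)
  simp

theorem integral_abs_pow_mul_exp_scale (k : ℕ) {R : ℝ} (hR : 0 < R) :
    ∫ x : ℝ, |x| ^ k * Real.exp (-(R ^ 2 * x ^ 2 / 4))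
      = (∫ x : ℝ, |x| ^ k * Real.exp (-(x ^ 2 / 4))) / R ^ (k + 1) := by
  have h := Measure.integral_comp_mul_left (fun x : ℝ => |x| ^ k * Real.exp (-(x ^ 2 / 4))) R
  have e : ∀ x : ℝ, |R * x| ^ k * Real.exp (-((R * x) ^ 2 / 4))
      = R ^ k * (|x| ^ k * Real.exp (-(R ^ 2 * x ^ 2 / 4))) := fun x => by
    rw [abs_mul, abs_of_pos hR, mul_pow, mul_pow, mul_assoc]
  simp_rw [e] at h
  rw [integral_const_mul, abs_inv, abs_of_pos hR, smul_eq_mul] at h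
  rw [eq_div_iff (by positivity),
    ← mul_inv_cancel_left₀ hR.ne' (∫ x : ℝ, |x| ^ k * Real.exp (-(x ^ 2 / 4))), ← h]
  ring

/-- The integral bound for the distance between densities. Near the origin the characteristic
functions are compared by `hnear`; beyond `R² / (32 S)` the Gaussian one is absorbed by the factor
`32 S |u| / R² ≥ 1`, and the other one is bounded by `T / u²`. -/
theorem exists_integrable_bound_charFun_sub {φ : ℝ → ℂ} {R S ε T : ℝ} (hR : 0 < R) (hS : 0 ≤ S)
    (hε : 0 < ε) (hT : 0 ≤ T) (hεS : 32 * S * ε ≤ R ^ 2)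
    (hnear : ∀ u : ℝ, 32 * S * |u| ≤ R ^ 2 →
      ‖φ u - Real.exp (-(R ^ 2 * u ^ 2 / 2))‖
        ≤ 5 * S * |u| ^ 3 * Real.exp (-(R ^ 2 * u ^ 2 / 4)))
    (hfar : ∀ u : ℝ, ε ≤ |u| → ‖φ u‖ ≤ T / u ^ 2) :
    ∃ G : ℝ → ℝ, Integrable G ∧ (∀ u, ‖φ u - Real.exp (-(R ^ 2 * u ^ 2 / 2))‖ ≤ G u) ∧
      ∫ u, G u = (5 * (∫ x : ℝ, |x| ^ 3 * Real.exp (-(x ^ 2 / 4)))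
        + 32 * ∫ x : ℝ, |x| ^ 1 * Real.exp (-(x ^ 2 / 4))) * S / R ^ 4
        + T * (1 + 1 / ε ^ 2) * Real.pi := by
  have hint : ∀ k : ℕ, Integrable fun x : ℝ => |x| ^ k * Real.exp (-(R ^ 2 * x ^ 2 / 4)) :=
    fun k => (integrable_abs_pow_mul_exp k (b := R ^ 2 / 4) (by positivity)).congr
      (ae_of_all _ fun x => by simp only; congr 3; ring)
  have i3 := (hint 3).const_mul (5 * S)
  have i1 := (hint 1).const_mul (32 * S / R ^ 2)
  have iT := integrable_inv_one_add_sq.const_mul (T * (1 + 1 / ε ^ 2))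
  refine ⟨_, (i3.add i1).add iT, fun u => ?_, ?_⟩
  · simp only [Pi.add_apply]
    have n1 : 0 ≤ 5 * S * (|u| ^ 3 * Real.exp (-(R ^ 2 * u ^ 2 / 4))) := by positivity
    have n2 : 0 ≤ 32 * S / R ^ 2 * (|u| ^ 1 * Real.exp (-(R ^ 2 * u ^ 2 / 4))) := by positivity
    have n3 : 0 ≤ T * (1 + 1 / ε ^ 2) * (1 + u ^ 2)⁻¹ := by positivity
    by_cases hu : 32 * S * |u| ≤ R ^ 2
    · have := hnear u hu
      rw [mul_assoc] at this
      linarith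
    · push Not at hu
      have hεu : ε ≤ |u| := by
        by_contra! hlt
        have : 32 * S * |u| ≤ 32 * S * ε := by gcongr
        linarith
      have hu2 : ε ^ 2 ≤ u ^ 2 := by
        rw [← sq_abs u]
        gcongr
      have h1 : ‖φ u‖ ≤ T * (1 + 1 / ε ^ 2) * (1 + u ^ 2)⁻¹ := by
        refine (hfar u hεu).trans ?_
        have hu0 : 0 < u ^ 2 := lt_of_lt_of_le (by positivity) hu2
        rw [← div_eq_mul_inv, div_le_div_iff₀ hu0 (by positivity), mul_assoc]
        refine mul_le_mul_of_nonneg_left ?_ hT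
        rw [add_mul, one_mul, div_mul_eq_mul_div, one_mul, add_comm]
        gcongr
        rwa [one_le_div (by positivity)]
      have h2 : ‖(Real.exp (-(R ^ 2 * u ^ 2 / 2)) : ℂ)‖
          ≤ 32 * S / R ^ 2 * (|u| ^ 1 * Real.exp (-(R ^ 2 * u ^ 2 / 4))) := by
        rw [Complex.norm_real, Real.norm_eq_abs, Real.abs_exp, pow_one, ← mul_assoc]
        have h3 : 1 ≤ 32 * S / R ^ 2 * |u| := by
          rw [div_mul_eq_mul_div, one_le_div (by positivity)]
          exact hu.le
        have h4 : Real.exp (-(R ^ 2 * u ^ 2 / 2)) ≤ Real.exp (-(R ^ 2 * u ^ 2 / 4)) := by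
          refine Real.exp_le_exp.2 ?_
          have : 0 ≤ R ^ 2 * u ^ 2 := by positivity
          linarith
        exact h4.trans (le_mul_of_one_le_left (Real.exp_pos _).le h3)
      have := norm_sub_le (φ u) (Real.exp (-(R ^ 2 * u ^ 2 / 2)) : ℂ)
      linarith
  · rw [integral_add' (i3.add i1) iT, integral_add' i3 i1, integral_const_mul,
      integral_const_mul, integral_const_mul,
      integral_univ_inv_one_add_sq, integral_abs_pow_mul_exp_scale 3 hR,
      integral_abs_pow_mul_exp_scale 1 hR]
    field_simp
    ring

/-! ### Counting the factors that decay -/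

/-- If `N` of the first `n` factors belong to the subsequence `ν`, then the first two of them may
be estimated individually and the other `N - 2` by their common bound `ρ`. -/
theorem prod_le_of_subsequence {ν : ℕ → ℕ} (hν : StrictMono ν) {a : ℕ → ℝ} (ha0 : ∀ i, 0 ≤ a i)
    (ha1 : ∀ i, a i ≤ 1) {ρ : ℝ} {n : ℕ} (hρ : ∀ m, ν m + 1 ≤ n → a (ν m) ≤ ρ)
    (hN : 2 ≤ Set.ncard {m : ℕ | ν m + 1 ≤ n}) :
    ∏ i ∈ Finset.range n, a i
      ≤ a (ν 0) * a (ν 1) * ρ ^ (Set.ncard {m : ℕ | ν m + 1 ≤ n} - 2) := by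
  classical
  set M : Finset ℕ := (Finset.range n).filter fun m => ν m + 1 ≤ n with hM
  have hmem : ∀ m, m ∈ M ↔ ν m + 1 ≤ n := fun m => by
    have := hν.le_apply (x := m)
    simp only [hM, Finset.mem_filter, Finset.mem_range]
    omega
  have hcard : Set.ncard {m : ℕ | ν m + 1 ≤ n} = M.card := by
    rw [← Set.ncard_coe_finset]
    congr 1
    ext m
    simp [hmem]
  rw [hcard] at hN ⊢
  have h1 : 1 ∈ M := by
    obtain ⟨m, hm, hm0⟩ := Finset.exists_mem_ne (by omega : 1 < M.card) 0
    have h2 : ν 1 ≤ ν m := hν.monotone (Nat.one_le_iff_ne_zero.2 hm0)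
    rw [hmem] at hm ⊢
    omega
  have h0 : 0 ∈ M := by
    have h2 : ν 0 < ν 1 := hν zero_lt_one
    rw [hmem] at h1 ⊢
    omega
  calc ∏ i ∈ Finset.range n, a i ≤ ∏ i ∈ M.image ν, a i := by
        have hsub : M.image ν ⊆ Finset.range n := by
          intro i hi
          obtain ⟨m, hm, rfl⟩ := Finset.mem_image.1 hi
          rw [hmem] at hm
          simpa using hm
        exact Finset.prod_le_prod_of_subset_of_le_one hsub (fun i _ => ha0 i)
          fun i _ _ => ha1 i
    _ = ∏ m ∈ M, a (ν m) := Finset.prod_image fun x _ y _ h => hν.injective h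
    _ = a (ν 0) * a (ν 1) * ∏ m ∈ (M.erase 0).erase 1, a (ν m) := by
        rw [mul_assoc, Finset.mul_prod_erase (M.erase 0) (fun m => a (ν m)) (by simp [h1]),
          Finset.mul_prod_erase M (fun m => a (ν m)) h0]
    _ ≤ a (ν 0) * a (ν 1) * ∏ m ∈ (M.erase 0).erase 1, ρ := by
        refine mul_le_mul_of_nonneg_left ?_ (mul_nonneg (ha0 _) (ha0 _))
        refine Finset.prod_le_prod (fun m _ => ha0 _) fun m hm => hρ m ?_
        exact (hmem m).1 (Finset.mem_of_mem_erase (Finset.mem_of_mem_erase hm))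
    _ = a (ν 0) * a (ν 1) * ρ ^ (M.card - 2) := by
        rw [Finset.prod_const, Finset.card_erase_of_mem (by simp [h1]),
          Finset.card_erase_of_mem h0, Nat.sub_sub]

/-- A positive lower density of order `n ^ lam` makes the number of factors beyond the first two
at least a multiple of `n ^ lam`. -/
theorem exists_eventually_le_ncard_sub_two {ν : ℕ → ℕ} {lam : ℝ} (hlam : 0 < lam)
    (h : 0 < liminf (subseqDensity ν lam) atTop) :
    ∃ d : ℝ, 0 < d ∧ ∀ᶠ n : ℕ in atTop, 2 ≤ Set.ncard {m : ℕ | ν m + 1 ≤ n} ∧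
      d * (n : ℝ) ^ lam ≤ ((Set.ncard {m : ℕ | ν m + 1 ≤ n} - 2 : ℕ) : ℝ) := by
  obtain ⟨b, hb0, hb⟩ := ENNReal.lt_iff_exists_real_btwn.1 h
  obtain ⟨hb1, hb2⟩ := hb
  have hbpos : 0 < b := ENNReal.ofReal_pos.1 hb1
  have hev := eventually_lt_of_lt_liminf hb2
  have hpow : Tendsto (fun n : ℕ => (n : ℝ) ^ lam) atTop atTop :=
    (tendsto_rpow_atTop hlam).comp tendsto_natCast_atTop_atTop
  refine ⟨b / 2, by positivity, ?_⟩
  filter_upwards [hev, eventually_gt_atTop 0, hpow.eventually_ge_atTop (4 / b)] with n hn hn0 hn4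
  have hn0' : (0 : ℝ) < n := by exact_mod_cast hn0
  have hle : b * (n : ℝ) ^ lam ≤ (Set.ncard {m : ℕ | ν m + 1 ≤ n} : ℝ) := by
    have h1 := ((ENNReal.le_div_iff_mul_le (by simp [hn0.ne']) (by simp [hlam.le])).1
      hn.le)
    rw [← ENNReal.ofReal_natCast n, ENNReal.ofReal_rpow_of_pos hn0', ← ENNReal.ofReal_mul hb0,
      ← ENNReal.ofReal_natCast] at h1
    exact (ENNReal.ofReal_le_ofReal_iff (Nat.cast_nonneg _)).1 h1
  rw [div_le_iff₀ hbpos] at hn4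
  have h4 : (4 : ℝ) ≤ (Set.ncard {m : ℕ | ν m + 1 ≤ n} : ℝ) := by linarith
  have h2 : 2 ≤ Set.ncard {m : ℕ | ν m + 1 ≤ n} := by
    have : 4 ≤ Set.ncard {m : ℕ | ν m + 1 ≤ n} := by exact_mod_cast h4
    omega
  refine ⟨h2, ?_⟩
  rw [Nat.cast_sub h2]
  push_cast
  linarith

/-- The hypothesis on the total variations in real terms. -/
theorem exists_variation_le_of_iInf_pos {ν : ℕ → ℕ} {s : ℝ} {p : ℕ → ℝ → ℝ}
    (h : 0 < ⨅ m, ENNReal.ofReal (((ν m + 1 : ℕ) : ℝ) ^ s) / ∫⁻ x, ‖deriv (p (ν m)) x‖ₑ) :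
    ∃ K : ℝ, 0 < K ∧ ∀ m, ∫⁻ x, ‖deriv (p (ν m)) x‖ₑ
      ≤ ENNReal.ofReal (K * ((ν m + 1 : ℕ) : ℝ) ^ s) := by
  obtain ⟨b, hb0, hb1, hb2⟩ := ENNReal.lt_iff_exists_real_btwn.1 h
  have hbpos : 0 < b := ENNReal.ofReal_pos.1 hb1
  refine ⟨b⁻¹, by positivity, fun m => ?_⟩
  have hm := hb2.le.trans (iInf_le _ m)
  have hpos : (0 : ℝ) < ((ν m + 1 : ℕ) : ℝ) ^ s := by positivity
  have h1 := (ENNReal.le_div_iff_mul_le (Or.inr (ENNReal.ofReal_pos.2 hpos).ne')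
    (Or.inr ENNReal.ofReal_ne_top)).1 hm
  rw [ENNReal.ofReal_mul (by positivity), ENNReal.ofReal_inv_of_pos hbpos]
  rw [mul_comm, ← div_eq_mul_inv, ENNReal.le_div_iff_mul_le (Or.inl hb1.ne')
    (Or.inl ENNReal.ofReal_ne_top), mul_comm]
  exact h1

/-! ### The density of the normalized sum -/

namespace HasACDensity

variable {Ω : Type*} [MeasurableSpace Ω] {P : Measure Ω} {X : Ω → ℝ} {p : ℝ → ℝ}

theorem absolutelyContinuous (h : HasACDensity P X p) : P.map X ≪ volume := by
  rw [h.map_eq]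
  exact withDensity_absolutelyContinuous _ _

theorem variance_pos [IsProbabilityMeasure P] (h : HasACDensity P X p) (hX : Measurable X)
    (h3 : MemLp X 3 P) (h0 : ∫ ω, X ω ∂P = 0) : 0 < variance X P := by
  refine lt_of_le_of_ne (variance_nonneg _ _) fun hv => ?_
  have hL2 : Integrable (fun ω => X ω ^ 2) P := (h3.mono_exponent (by norm_num)).integrable_sq
  rw [variance_of_integral_eq_zero hX.aemeasurable h0, eq_comm,
    integral_eq_zero_iff_of_nonneg (fun ω => sq_nonneg _) hL2] at hv
  have hnull : P (X ⁻¹' {0}) = 0 := by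
    rw [← Measure.map_apply hX (measurableSet_singleton 0)]
    exact h.absolutelyContinuous Real.volume_singleton
  have hfull : ∀ᵐ _ ∂P, False := by
    filter_upwards [hv, measure_eq_zero_iff_ae_notMem.1 hnull] with ω h1 h2
    exact h2 (pow_eq_zero_iff two_ne_zero |>.1 h1)
  exact hfull.exists.choose_spec

end HasACDensity

section Sum

variable {Ω : Type*} [MeasurableSpace Ω] {P : Measure Ω}
  {X : ℕ → Ω → ℝ} {p : ℕ → ℝ → ℝ}

theorem map_sum_eq_conv [IsProbabilityMeasure P]
    (hX : ∀ i, Measurable (X i)) (hind : iIndepFun X P) {j n : ℕ}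
    (hj : j < n) : P.map (fun ω => ∑ i ∈ Finset.range n, X i ω)
      = P.map (X j) ∗ P.map (∑ i ∈ (Finset.range n).erase j, X i) := by
  rw [← (hind.indepFun_finsetSum_of_notMem hX
    (Finset.notMem_erase j (Finset.range n))).symm.map_add_eq_map_conv_map (hX j)
    (by fun_prop)]
  congr 1
  ext ω
  rw [Pi.add_apply, Finset.sum_apply, Finset.add_sum_erase _ (fun i => X i ω)
    (Finset.mem_range.2 hj)]

theorem varSum_pos [IsProbabilityMeasure P]
    (hX : ∀ i, Measurable (X i)) (hp : ∀ i, HasACDensity P (X i) (p i))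
    (h3 : ∀ i, MemLp (X i) 3 P) (h0 : ∀ i, ∫ ω, X i ω ∂P = 0) {n : ℕ} (hn : 1 ≤ n) :
    0 < varSum P X n :=
  Finset.sum_pos (fun i _ => (hp i).variance_pos (hX i) (h3 i) (h0 i))
    ⟨0, Finset.mem_range.2 hn⟩

theorem measurable_normalizedSum (hX : ∀ i, Measurable (X i)) (n : ℕ) :
    Measurable (normalizedSum P X n) :=
  (Finset.measurable_fun_sum _ fun i _ => hX i).div_const _

theorem hasPDF_normalizedSum [IsProbabilityMeasure P]
    (hX : ∀ i, Measurable (X i)) (hind : iIndepFun X P)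
    (hp : ∀ i, HasACDensity P (X i) (p i)) {n : ℕ} (hn : 1 ≤ n) (hB : 0 < varSum P X n) :
    HasPDF (normalizedSum P X n) P volume := by
  have hsum : Measurable fun ω => ∑ i ∈ Finset.range n, X i ω :=
    Finset.measurable_fun_sum _ fun i _ => hX i
  rw [Real.hasPDF_iff_of_aemeasurable (measurable_normalizedSum hX n).aemeasurable]
  have hac : P.map (fun ω => ∑ i ∈ Finset.range n, X i ω) ≪ volume := by
    rw [map_sum_eq_conv hX hind (show 0 < n from hn), Measure.conv_comm]
    exact Measure.conv_absolutelyContinuous (hp 0).absolutelyContinuous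
  refine Measure.AbsolutelyContinuous.mk fun s hs hs0 => ?_
  have hR : (√(varSum P X n))⁻¹ ≠ 0 := (inv_pos.2 (Real.sqrt_pos.2 hB)).ne'
  rw [Measure.map_apply (measurable_normalizedSum hX n) hs]
  have hpre : normalizedSum P X n ⁻¹' s = (fun ω => ∑ i ∈ Finset.range n, X i ω) ⁻¹'
      ((fun x => (√(varSum P X n))⁻¹ * x) ⁻¹' s) := by
    ext ω
    simp [normalizedSum, div_eq_inv_mul]
  rw [hpre, ← Measure.map_apply hsum (measurable_const_mul _ hs)]
  refine hac ?_
  rw [Real.volume_preimage_mul_left hR, hs0, mul_zero]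

/-- As soon as one summand has a density of finite total variation, the sum has a bounded
continuous density. -/
theorem exists_continuous_density_sum [IsProbabilityMeasure P]
    (hX : ∀ i, Measurable (X i)) (hind : iIndepFun X P)
    (hp : ∀ i, HasACDensity P (X i) (p i)) {j n : ℕ} (hj : j < n) {V : ℝ} (hV : 0 ≤ V)
    (hpV : ∫⁻ x, ‖deriv (p j) x‖ₑ ≤ ENNReal.ofReal V) :
    ∃ q : ℝ → ℝ, Continuous q ∧ (∀ x, 0 ≤ q x) ∧ (∀ x, q x ≤ V + 1) ∧
      P.map (fun ω => ∑ i ∈ Finset.range n, X i ω)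
        = volume.withDensity fun x => ENNReal.ofReal (q x) := by
  have hle := (hp j).le_add_one (hX j) hV hpV
  have hsum : Measurable (∑ i ∈ (Finset.range n).erase j, X i) := by
    fun_prop
  have := Measure.isProbabilityMeasure_map (μ := P) hsum.aemeasurable
  refine ⟨_, continuous_integral_translate (ν := P.map (∑ i ∈ (Finset.range n).erase j, X i))
    (hp j).continuous (hp j).nonneg hle, fun x => integral_nonneg fun z => (hp j).nonneg _,
    integral_translate_le (hp j).continuous (hp j).nonneg hle, ?_⟩
  rw [map_sum_eq_conv hX hind hj, (hp j).map_eq,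
    withDensity_conv_eq (hp j).continuous (hp j).nonneg hle]

theorem sumDensity_ae_eq [IsProbabilityMeasure P]
    (hX : ∀ i, Measurable (X i)) {n : ℕ} (hB : 0 < varSum P X n)
    {q : ℝ → ℝ} (hq : Continuous q) (hq0 : ∀ x, 0 ≤ q x)
    (hmap : P.map (fun ω => ∑ i ∈ Finset.range n, X i ω)
      = volume.withDensity fun x => ENNReal.ofReal (q x)) :
    sumDensity P X n =ᵐ[volume] fun x => √(varSum P X n) * q (√(varSum P X n) * x) := by
  have hR : 0 < √(varSum P X n) := Real.sqrt_pos.2 hB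
  have hsum : Measurable fun ω => ∑ i ∈ Finset.range n, X i ω :=
    Finset.measurable_fun_sum _ fun i _ => hX i
  have hf : Measurable fun x =>
      ENNReal.ofReal (√(varSum P X n) * q (√(varSum P X n) * x)) := by
    have := hq.measurable
    fun_prop
  have hmap' : P.map (normalizedSum P X n) = volume.withDensity fun x =>
      ENNReal.ofReal (√(varSum P X n) * q (√(varSum P X n) * x)) := by
    rw [← map_div_withDensity_ofReal hq.measurable hR, ← hmap,
      Measure.map_map (by fun_prop) hsum]
    rfl
  have := hasPDF_of_map_eq_withDensity (measurable_normalizedSum hX n).aemeasurable _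
    hf.aemeasurable hmap'
  filter_upwards [(pdf.eq_of_map_eq_withDensity' _ hf.aemeasurable).1 hmap'] with x hx
  rw [sumDensity, hx, ENNReal.toReal_ofReal (mul_nonneg hR.le (hq0 _))]

theorem densityDist_le_of_abs_sub_le [IsProbabilityMeasure P]
    (hX : ∀ i, Measurable (X i)) {n : ℕ}
    (hB : 0 < varSum P X n) {q : ℝ → ℝ} (hq : Continuous q) (hq0 : ∀ x, 0 ≤ q x)
    (hmap : P.map (fun ω => ∑ i ∈ Finset.range n, X i ω)
      = volume.withDensity fun x => ENNReal.ofReal (q x)) {D : ℝ}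
    (hD : ∀ x, |q x - gaussianPDFReal 0 (varSum P X n).toNNReal x| ≤ D) :
    densityDist P X n ≤ ENNReal.ofReal (√(varSum P X n) * D) := by
  rw [densityDist, eLpNorm_exponent_top]
  refine eLpNormEssSup_le_of_ae_bound ?_
  filter_upwards [sumDensity_ae_eq hX hB hq hq0 hmap] with x hx
  rw [hx, gaussianPDFReal_one_eq_sqrt_mul hB, ← mul_sub, norm_mul, Real.norm_eq_abs,
    Real.norm_eq_abs, abs_of_nonneg (Real.sqrt_nonneg _)]
  exact mul_le_mul_of_nonneg_left (hD _) (Real.sqrt_nonneg _)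

theorem eLpNorm_sumDensity_lt_top [IsProbabilityMeasure P]
    (hX : ∀ i, Measurable (X i)) {n : ℕ}
    (hB : 0 < varSum P X n) {q : ℝ → ℝ} (hq : Continuous q) (hq0 : ∀ x, 0 ≤ q x) {M : ℝ}
    (hqM : ∀ x, q x ≤ M) (hmap : P.map (fun ω => ∑ i ∈ Finset.range n, X i ω)
      = volume.withDensity fun x => ENNReal.ofReal (q x)) :
    eLpNorm (sumDensity P X n) ∞ volume < ∞ := by
  rw [eLpNorm_exponent_top]
  refine (eLpNormEssSup_le_of_ae_bound (C := √(varSum P X n) * M) ?_).trans_lt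
    ENNReal.ofReal_lt_top
  filter_upwards [sumDensity_ae_eq hX hB hq hq0 hmap] with x hx
  rw [hx, Real.norm_eq_abs, abs_of_nonneg (mul_nonneg (Real.sqrt_nonneg _) (hq0 _))]
  exact mul_le_mul_of_nonneg_left (hqM _) (Real.sqrt_nonneg _)

theorem densityDist_lt_top {n : ℕ} (h : eLpNorm (sumDensity P X n) ∞ volume < ∞) :
    densityDist P X n < ∞ := by
  have hm : AEStronglyMeasurable (sumDensity P X n) volume :=
    (measurable_pdf _ P volume).ennreal_toReal.aestronglyMeasurable
  refine (eLpNorm_sub_le hm (measurable_gaussianPDFReal 0 1).aestronglyMeasurable le_top).trans_lt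
    (ENNReal.add_lt_top.2 ⟨h, ?_⟩)
  rw [eLpNorm_exponent_top]
  refine (eLpNormEssSup_le_of_ae_bound (C := (√(2 * Real.pi * (1 : NNReal)))⁻¹)
    (ae_of_all _ fun x => ?_)).trans_lt ENNReal.ofReal_lt_top
  rw [Real.norm_eq_abs, abs_of_nonneg (gaussianPDFReal_nonneg _ _ _), gaussianPDFReal]
  refine mul_le_of_le_one_right (by positivity) (Real.exp_le_one_iff.2 ?_)
  rw [neg_div]
  exact neg_nonpos.2 (by positivity)

theorem charFun_map_sum_eq_prod (hX : ∀ i, Measurable (X i)) (hind : iIndepFun X P) (n : ℕ)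
    (u : ℝ) : charFun (P.map fun ω => ∑ i ∈ Finset.range n, X i ω) u
      = ∏ i ∈ Finset.range n, charFun (P.map (X i)) u := by
  rw [iIndepFun.charFun_map_fun_finsetSum_eq_prod (fun i _ => (hX i).aemeasurable)
    (hind.restrict _), Finset.prod_apply]

/-- The absolute constant of the estimate: the Gaussian moments that arise from integrating the
comparison bound near the origin and the Gaussian tail. The summand `1` only makes its positivity
immediate. -/
noncomputable def absoluteConstant : ℝ :=
  5 * (∫ x : ℝ, |x| ^ 3 * Real.exp (-(x ^ 2 / 4)))
    + 32 * (∫ x : ℝ, |x| ^ 1 * Real.exp (-(x ^ 2 / 4))) + 1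

theorem absoluteConstant_pos : 0 < absoluteConstant := by
  have h : ∀ k : ℕ, 0 ≤ ∫ x : ℝ, |x| ^ k * Real.exp (-(x ^ 2 / 4)) :=
    fun k => integral_nonneg fun x => by positivity
  have := h 3
  have := h 1
  rw [absoluteConstant]
  positivity

theorem thirdMomentSum_nonneg (n : ℕ) : 0 ≤ thirdMomentSum P X n :=
  Finset.sum_nonneg fun i _ => integral_nonneg fun ω => by positivity

/-- The estimate for one fixed `n` whose Lyapunov ratio is small, given a bound `T / u ^ 2` for
the characteristic function of the sum away from the origin. -/
theorem densityDist_le_of_tail [IsProbabilityMeasure P]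
    (hX : ∀ i, Measurable (X i)) (hind : iIndepFun X P)
    (h3 : ∀ i, MemLp (X i) 3 P) (h0 : ∀ i, ∫ ω, X i ω ∂P = 0) {n : ℕ} (hB : 0 < varSum P X n)
    {q : ℝ → ℝ} (hq : Continuous q) (hq0 : ∀ x, 0 ≤ q x)
    (hmap : P.map (fun ω => ∑ i ∈ Finset.range n, X i ω)
      = volume.withDensity fun x => ENNReal.ofReal (q x))
    (hsmall : 8 * thirdMomentSum P X n ≤ √(varSum P X n) ^ 3) {ε T : ℝ} (hε : 0 < ε)
    (hT : 0 ≤ T) (hεS : 32 * thirdMomentSum P X n * ε ≤ varSum P X n)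
    (hfar : ∀ u : ℝ, ε ≤ |u| → ∏ i ∈ Finset.range n, ‖charFun (P.map (X i)) u‖ ≤ T / u ^ 2) :
    densityDist P X n ≤ ENNReal.ofReal
      (absoluteConstant * varSum P X n ^ (-(3 / 2) : ℝ) * thirdMomentSum P X n
        + T * (1 + 1 / ε ^ 2) * Real.pi * √(varSum P X n)) := by
  set B := varSum P X n with hBdef
  set S := thirdMomentSum P X n with hSdef
  set R := √B with hRdef
  have hR : 0 < R := Real.sqrt_pos.2 hB
  have hR2 : R ^ 2 = B := Real.sq_sqrt hB.le
  have hS0 : 0 ≤ S := thirdMomentSum_nonneg n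
  have hB0 : B.toNNReal ≠ 0 := (Real.toNNReal_pos.2 hB).ne'
  have hprob : ∀ i, IsProbabilityMeasure (P.map (X i)) := fun i =>
    Measure.isProbabilityMeasure_map (hX i).aemeasurable
  have hsum : Measurable fun ω => ∑ i ∈ Finset.range n, X i ω :=
    Finset.measurable_fun_sum _ fun i _ => hX i
  have hprobS := Measure.isProbabilityMeasure_map (μ := P) hsum.aemeasurable
  obtain ⟨G, hG, hle, hGint⟩ := exists_integrable_bound_charFun_sub
    (φ := fun u => ∏ i ∈ Finset.range n, charFun (P.map (X i)) u) hR hS0 hε hT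
    (by rwa [hR2]) (fun u hu => by
      have e : ∀ i ∈ Finset.range n, √(variance (X i) P) ^ 2 = variance (X i) P :=
        fun i _ => Real.sq_sqrt (variance_nonneg _ _)
      have := norm_prod_sub_exp_le (Finset.range n) (fun i => charFun (P.map (X i)) u)
        (fun i => √(variance (X i) P)) (fun i => ∫ ω, |X i ω| ^ 3 ∂P) hR (abs_nonneg u)
        (fun i _ => Real.sqrt_nonneg _)
        (fun i _ => sqrt_variance_pow_three_le (hX i) (h3 i) (h0 i))
        (fun i _ => norm_charFun_le_one u)
        (fun i hi => by
          rw [e i hi, sq_abs]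
          exact norm_charFun_map_sub_le (hX i) (h3 i) (h0 i) u)
        (by rw [Finset.sum_congr rfl e, hR2, hBdef, varSum]) hsmall hu
      rwa [sq_abs] at this)
    (fun u hu => by rw [norm_prod]; exact hfar u hu)
  have hqi : Integrable q := by
    refine ⟨hq.aestronglyMeasurable, ?_⟩
    have h1 := measure_univ (μ := P.map fun ω => ∑ i ∈ Finset.range n, X i ω)
    rw [hmap, withDensity_apply _ MeasurableSet.univ, Measure.restrict_univ] at h1
    rw [hasFiniteIntegral_iff_ofReal (ae_of_all _ hq0), h1]
    exact ENNReal.one_lt_top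
  have hgauss : (volume.withDensity fun x => ENNReal.ofReal (gaussianPDFReal 0 B.toNNReal x))
      = gaussianReal 0 B.toNNReal := by
    rw [gaussianReal_of_var_ne_zero _ hB0, gaussianPDF_def]
  have hD := abs_sub_le_integral_of_norm_charFun_sub_le (q₂ := gaussianPDFReal 0 B.toNNReal)
    hq (by unfold gaussianPDFReal; fun_prop) hqi (integrable_gaussianPDFReal 0 B.toNNReal) hq0
    (gaussianPDFReal_nonneg 0 B.toNNReal) hG (fun u => by
      refine le_trans (le_of_eq ?_) (hle u)
      rw [← hmap, charFun_map_sum_eq_prod hX hind, hgauss, charFun_gaussianReal, hR2]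
      rw [Complex.ofReal_exp, Real.coe_toNNReal _ hB.le]
      congr 3
      push_cast
      ring)
  refine (densityDist_le_of_abs_sub_le hX hB hq hq0 hmap hD).trans
    (ENNReal.ofReal_le_ofReal ?_)
  rw [hGint]
  have hpow : B ^ (-(3 / 2) : ℝ) = (R ^ 3)⁻¹ := by
    rw [Real.rpow_neg hB.le, hRdef, Real.sqrt_eq_rpow, ← Real.rpow_natCast, ← Real.rpow_mul hB.le]
    norm_num
  rw [hpow, absoluteConstant, mul_add]
  refine add_le_add ?_ (by rw [mul_comm])
  have hx : 0 ≤ (R ^ 3)⁻¹ * S := by positivity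
  have hy : ∀ K : ℝ, R * (K * S / R ^ 4) = K * ((R ^ 3)⁻¹ * S) := fun K => by field_simp
  rw [hy, mul_assoc _ (R ^ 3)⁻¹]
  nlinarith

end Sum

/-! ### The uniform estimate -/

section Uniform

variable {Ω : Type*} [MeasurableSpace Ω] {P : Measure Ω} [IsProbabilityMeasure P]
  {X : ℕ → Ω → ℝ} {p : ℕ → ℝ → ℝ} {ν : ℕ → ℕ} {lam s : ℝ}

/-- Away from the origin, two members of the subsequence give the integrable factor `1 / u ^ 2`,
and each of the remaining `d * n ^ lam` ones gives a factor `exp (-c * n ^ (-2 * s))`. -/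
theorem prod_norm_charFun_le (hX : ∀ i, Measurable (X i))
    (hp : ∀ i, HasACDensity P (X i) (p i)) (hν : StrictMono ν) (hs : 0 < s) {K ε d : ℝ}
    (hK : 0 < K) (hε : 0 < ε) (hεK : ε ≤ K)
    (hpK : ∀ m, ∫⁻ x, ‖deriv (p (ν m)) x‖ₑ ≤ ENNReal.ofReal (K * ((ν m + 1 : ℕ) : ℝ) ^ s))
    {n : ℕ} (hn : 1 ≤ n) (hN : 2 ≤ Set.ncard {m : ℕ | ν m + 1 ≤ n})
    (hd : d * (n : ℝ) ^ lam ≤ ((Set.ncard {m : ℕ | ν m + 1 ≤ n} - 2 : ℕ) : ℝ)) {u : ℝ}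
    (hu : ε ≤ |u|) :
    ∏ i ∈ Finset.range n, ‖charFun (P.map (X i)) u‖
      ≤ 4 * (K * ((ν 0 + 1 : ℕ) : ℝ) ^ s) * (K * ((ν 1 + 1 : ℕ) : ℝ) ^ s)
        * Real.exp (-(ε ^ 2 * d / (128 * K ^ 2)) * (n : ℝ) ^ (lam - 2 * s)) / u ^ 2 := by
  have hn0 : (0 : ℝ) < n := by exact_mod_cast hn
  have hn1 : (1 : ℝ) ≤ n := by exact_mod_cast hn
  have hu0 : u ≠ 0 := abs_pos.1 (hε.trans_le hu)
  have hprob : ∀ i, IsProbabilityMeasure (P.map (X i)) := fun i =>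
    Measure.isProbabilityMeasure_map (hX i).aemeasurable
  set W : ℝ := K * (n : ℝ) ^ s with hW
  have hW0 : 0 < W := by positivity
  have hKW : K ≤ W := le_mul_of_one_le_right hK.le (Real.one_le_rpow hn1 hs.le)
  have hdec : ∀ m, ∀ w : ℝ, w ≠ 0 → ‖charFun (P.map (X (ν m))) w‖
      ≤ 2 * (K * ((ν m + 1 : ℕ) : ℝ) ^ s) / |w| := fun m w hw =>
    (hp (ν m)).norm_charFun_le_div (hX _) (by positivity) (hpK m) hw
  have hρ : ∀ m, ν m + 1 ≤ n → ‖charFun (P.map (X (ν m))) u‖ ≤ 1 - ε ^ 2 / (128 * W ^ 2) := by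
    intro m hm
    refine norm_charFun_le_one_sub_of_le_div hW0 hε (by linarith) (fun w hw => ?_) hu
    refine (hdec m w hw).trans ?_
    rw [hW]
    gcongr
  have hprod := prod_le_of_subsequence hν (a := fun i => ‖charFun (P.map (X i)) u‖)
    (fun i => norm_nonneg _) (fun i => norm_charFun_le_one u) hρ hN
  have hρ0 : 0 ≤ 1 - ε ^ 2 / (128 * W ^ 2) := by
    have h1 : ε ^ 2 ≤ W ^ 2 := pow_le_pow_left₀ hε.le (hεK.trans hKW) 2
    rw [sub_nonneg, div_le_one (by positivity)]
    nlinarith [sq_nonneg W]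
  set N := Set.ncard {m : ℕ | ν m + 1 ≤ n} - 2 with hNdef
  have hpow : (1 - ε ^ 2 / (128 * W ^ 2)) ^ N
      ≤ Real.exp (-(ε ^ 2 * d / (128 * K ^ 2)) * (n : ℝ) ^ (lam - 2 * s)) := by
    refine (pow_le_pow_left₀ hρ0 (Real.one_sub_le_exp_neg _) N).trans ?_
    rw [← Real.exp_nat_mul]
    refine Real.exp_le_exp.2 ?_
    have e : -(ε ^ 2 * d / (128 * K ^ 2)) * (n : ℝ) ^ (lam - 2 * s)
        = d * (n : ℝ) ^ lam * -(ε ^ 2 / (128 * W ^ 2)) := by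
      rw [Real.rpow_sub hn0, mul_comm 2 s, Real.rpow_mul hn0.le, Real.rpow_ofNat, hW]
      field_simp
    rw [e]
    exact mul_le_mul_of_nonpos_right hd (neg_nonpos.2 (by positivity))
  refine hprod.trans ?_
  have h0 := hdec 0 u hu0
  have h1 := hdec 1 u hu0
  calc ‖charFun (P.map (X (ν 0))) u‖ * ‖charFun (P.map (X (ν 1))) u‖
        * (1 - ε ^ 2 / (128 * W ^ 2)) ^ N
      ≤ (2 * (K * ((ν 0 + 1 : ℕ) : ℝ) ^ s) / |u|) * (2 * (K * ((ν 1 + 1 : ℕ) : ℝ) ^ s) / |u|)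
        * Real.exp (-(ε ^ 2 * d / (128 * K ^ 2)) * (n : ℝ) ^ (lam - 2 * s)) := by
        gcongr
    _ = _ := by
        rw [← sq_abs u]
        field_simp
        ring

theorem eventually_densityDist_le (hX : ∀ i, Measurable (X i)) (hind : iIndepFun X P)
    (hp : ∀ i, HasACDensity P (X i) (p i)) (h3 : ∀ i, MemLp (X i) 3 P)
    (h0 : ∀ i, ∫ ω, X i ω ∂P = 0) (hB : Tendsto (varSum P X) atTop atTop)
    (hO : thirdMomentSum P X =O[atTop] varSum P X) (hν : StrictMono ν) (hlam : 0 < lam)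
    (hdens : 0 < liminf (subseqDensity ν lam) atTop) (hs : 0 < s)
    (hvar : 0 < ⨅ m, ENNReal.ofReal (((ν m + 1 : ℕ) : ℝ) ^ s) / ∫⁻ x, ‖deriv (p (ν m)) x‖ₑ) :
    ∃ C₁ C₂ : ℝ, 0 < C₁ ∧ 0 < C₂ ∧ ∀ᶠ n : ℕ in atTop, densityDist P X n ≤ ENNReal.ofReal
      (absoluteConstant * varSum P X n ^ (-(3 / 2) : ℝ) * thirdMomentSum P X n +
        C₁ * √(varSum P X n) * Real.exp (-C₂ * (n : ℝ) ^ (lam - 2 * s))) := by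
  obtain ⟨A, hA, hO'⟩ := hO.exists_pos
  obtain ⟨K₀, hK₀, hpK₀⟩ := exists_variation_le_of_iInf_pos hvar
  obtain ⟨d, hd, hev⟩ := exists_eventually_le_ncard_sub_two hlam hdens
  -- With `S ≤ A * B`, this is a lower bound for the range `B / (32 S)` of the Gaussian comparison.
  set ε : ℝ := 1 / (32 * A) with hε
  have hε0 : 0 < ε := by positivity
  set K := max K₀ ε with hK
  have hK0 : 0 < K := lt_max_of_lt_left hK₀
  have hpK : ∀ m, ∫⁻ x, ‖deriv (p (ν m)) x‖ₑ
      ≤ ENNReal.ofReal (K * ((ν m + 1 : ℕ) : ℝ) ^ s) := fun m =>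
    (hpK₀ m).trans (ENNReal.ofReal_le_ofReal (by gcongr; exact le_max_left _ _))
  set T₀ : ℝ := 4 * (K * ((ν 0 + 1 : ℕ) : ℝ) ^ s) * (K * ((ν 1 + 1 : ℕ) : ℝ) ^ s) with hT₀
  have hT₀0 : 0 < T₀ := by positivity
  refine ⟨T₀ * (1 + 1 / ε ^ 2) * Real.pi, ε ^ 2 * d / (128 * K ^ 2), by positivity,
    by positivity, ?_⟩
  filter_upwards [hev, hO'.bound, eventually_ge_atTop (ν 0 + 1),
    hB.eventually_ge_atTop ((8 * A) ^ 2)] with n hn hS hnν hBn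
  have hn1 : 1 ≤ n := by omega
  have hB0 := varSum_pos hX hp h3 h0 hn1
  rw [Real.norm_eq_abs, Real.norm_eq_abs, abs_of_nonneg (thirdMomentSum_nonneg n),
    abs_of_pos hB0] at hS
  obtain ⟨q, hq, hq0, -, hmap⟩ := exists_continuous_density_sum hX hind hp
    (show ν 0 < n from hnν) (by positivity) (hpK 0)
  have hR : 8 * A ≤ √(varSum P X n) := Real.le_sqrt_of_sq_le hBn
  have hsq : √(varSum P X n) ^ 2 = varSum P X n := Real.sq_sqrt hB0.le
  have hsmall : 8 * thirdMomentSum P X n ≤ √(varSum P X n) ^ 3 := by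
    calc 8 * thirdMomentSum P X n ≤ 8 * A * varSum P X n := by linarith
      _ ≤ √(varSum P X n) * varSum P X n := by gcongr
      _ = √(varSum P X n) ^ 3 := by rw [← hsq]; simp; ring
  have hεS : 32 * thirdMomentSum P X n * ε ≤ varSum P X n := by
    rw [hε, mul_one_div, div_le_iff₀ (by positivity)]
    linarith
  have := densityDist_le_of_tail hX hind h3 h0 hB0 hq hq0 hmap hsmall hε0
    (T := T₀ * Real.exp (-(ε ^ 2 * d / (128 * K ^ 2)) * (n : ℝ) ^ (lam - 2 * s)))
    (by positivity) hεS (fun u hu => prod_norm_charFun_le hX hp hν hs hK0 hε0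
      (le_max_right _ _) hpK hn1 hn.1 hn.2 hu)
  refine this.trans_eq ?_
  congr 2
  ring

theorem densityDist_lt_top_of_bounded (hX : ∀ i, Measurable (X i)) (hind : iIndepFun X P)
    (hp : ∀ i, HasACDensity P (X i) (p i)) (h3 : ∀ i, MemLp (X i) 3 P)
    (h0 : ∀ i, ∫ ω, X i ω ∂P = 0)
    (hvar : 0 < ⨅ m, ENNReal.ofReal (((ν m + 1 : ℕ) : ℝ) ^ s) / ∫⁻ x, ‖deriv (p (ν m)) x‖ₑ)
    {n : ℕ} (hn : 1 ≤ n)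
    (h : ν 0 + 1 ≤ n ∨ eLpNorm (sumDensity P X n) ∞ volume < ∞) : densityDist P X n < ∞ := by
  rcases h with h | h
  · obtain ⟨K, hK, hpK⟩ := exists_variation_le_of_iInf_pos hvar
    obtain ⟨q, hq, hq0, hqM, hmap⟩ := exists_continuous_density_sum hX hind hp
      (show ν 0 < n from h) (by positivity) (hpK 0)
    exact densityDist_lt_top
      (eLpNorm_sumDensity_lt_top hX (varSum_pos hX hp h3 h0 hn) hq hq0 hqM hmap)
  · exact densityDist_lt_top h

end Uniform

/-- An eventual bound with a positive coefficient `g` is made valid for every index at which the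
left side is finite, by increasing the coefficient. -/
theorem exists_forall_le_of_eventually_le {D : ℕ → ℝ≥0∞} {f g : ℕ → ℝ} {Q : ℕ → Prop} {C : ℝ}
    (hC : 0 < C) (hf : ∀ n, Q n → 0 ≤ f n) (hg : ∀ n, Q n → 0 < g n) (hD : ∀ n, Q n → D n < ∞)
    (h : ∀ᶠ n in atTop, D n ≤ ENNReal.ofReal (f n + C * g n)) :
    ∃ C' : ℝ, 0 < C' ∧ ∀ n, Q n → D n ≤ ENNReal.ofReal (f n + C' * g n) := by
  obtain ⟨n₀, hn₀⟩ := eventually_atTop.1 h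
  have habs : ∀ m, 0 ≤ |(D m).toReal / g m| := fun m => abs_nonneg _
  have hsum : 0 ≤ ∑ m ∈ Finset.range n₀, |(D m).toReal / g m| :=
    Finset.sum_nonneg fun m _ => habs m
  refine ⟨C + ∑ m ∈ Finset.range n₀, |(D m).toReal / g m|, by positivity, fun n hn => ?_⟩
  have hgn := hg n hn
  rcases le_or_gt n₀ n with hle | hlt
  · refine (hn₀ n hle).trans (ENNReal.ofReal_le_ofReal ?_)
    gcongr
    linarith
  · rw [← ENNReal.ofReal_toReal (hD n hn).ne]
    refine ENNReal.ofReal_le_ofReal ?_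
    have h1 : |(D n).toReal / g n| ≤ ∑ m ∈ Finset.range n₀, |(D m).toReal / g m| :=
      Finset.single_le_sum (f := fun m => |(D m).toReal / g m|) (fun m _ => habs m)
        (Finset.mem_range.2 hlt)
    have h2 : (D n).toReal = (D n).toReal / g n * g n := by field_simp
    have h3 := le_abs_self ((D n).toReal / g n)
    have h4 : (D n).toReal / g n * g n
        ≤ (C + ∑ m ∈ Finset.range n₀, |(D m).toReal / g m|) * g n := by
      gcongr
      linarith
    linarith [hf n hn]

/-- Under polynomial growth of `B`, the stretched exponential beats `B ^ 2`. -/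
theorem exists_sq_mul_exp_le {B : ℕ → ℝ} {α C δ : ℝ} (hα : 0 < α) (hC : 0 < C) (hδ : 0 < δ)
    (hB : Tendsto (fun n : ℕ => B n / (n : ℝ) ^ α) atTop (𝓝 0)) :
    ∃ A : ℝ, 0 < A ∧ ∀ n : ℕ, 1 ≤ n → B n ^ 2 * Real.exp (-C * (n : ℝ) ^ δ) ≤ A := by
  have hlim : Tendsto (fun n : ℕ => ((n : ℝ) ^ δ) ^ (2 * α / δ) * Real.exp (-C * (n : ℝ) ^ δ))
      atTop (𝓝 0) :=
    (tendsto_rpow_mul_exp_neg_mul_atTop_nhds_zero (2 * α / δ) C hC).comp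
      ((tendsto_rpow_atTop hδ).comp tendsto_natCast_atTop_atTop)
  have hprod := (hB.pow 2).mul hlim
  obtain ⟨A, hA⟩ := hprod.bddAbove_range
  refine ⟨max A 1, lt_max_of_lt_right one_pos, fun n hn => le_max_of_le_left ?_⟩
  refine le_trans (le_of_eq ?_) (hA ⟨n, rfl⟩)
  have hn0 : (0 : ℝ) < n := by exact_mod_cast hn
  have e : ((n : ℝ) ^ δ) ^ (2 * α / δ) = ((n : ℝ) ^ α) ^ 2 := by
    rw [← Real.rpow_mul hn0.le, ← Real.rpow_natCast, ← Real.rpow_mul hn0.le]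
    congr 1
    field_simp
    norm_num
  have := (Real.rpow_pos_of_pos hn0 α).ne'
  simp only [e]
  field_simp

theorem mainTheorem8 :
    ∃ C₀ : ℝ, 0 < C₀ ∧
      ∀ (Ω : Type*) [MeasurableSpace Ω] (P : Measure Ω) [IsProbabilityMeasure P]
        -- the variable `X i` has the one-based number `i + 1`
        (X : ℕ → Ω → ℝ) (p : ℕ → ℝ → ℝ) (ν : ℕ → ℕ) (lam s : ℝ),
        (∀ i, Measurable (X i)) →
        iIndepFun X P →
        (∀ i, HasACDensity P (X i) (p i)) →
        (∀ i, MemLp (X i) 3 P) →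
        (∀ i, ∫ ω, X i ω ∂P = 0) →
        Tendsto (varSum P X) atTop atTop →
        thirdMomentSum P X =O[atTop] varSum P X →
        StrictMono ν →
        0 < lam →
        0 < liminf (subseqDensity ν lam) atTop →
        0 < s → s < lam / 2 →
        0 < ⨅ m, ENNReal.ofReal (((ν m + 1 : ℕ) : ℝ) ^ s) / ∫⁻ x, ‖deriv (p (ν m)) x‖ₑ →
        (∀ n, 1 ≤ n → HasPDF (normalizedSum P X n) P volume) ∧
        (∃ C₁ C₂ : ℝ, 0 < C₁ ∧ 0 < C₂ ∧
          ∀ n, 1 ≤ n → (ν 0 + 1 ≤ n ∨ eLpNorm (sumDensity P X n) ∞ volume < ∞) →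
            densityDist P X n ≤ ENNReal.ofReal
              (C₀ * varSum P X n ^ (-(3 / 2) : ℝ) * thirdMomentSum P X n +
                C₁ * √(varSum P X n) * Real.exp (-C₂ * (n : ℝ) ^ (lam - 2 * s)))) ∧
        (∀ α : ℝ, 0 < α →
          Tendsto (fun n : ℕ => varSum P X n / (n : ℝ) ^ α) atTop (𝓝 0) →
          ∃ C : ℝ, 0 < C ∧
            ∀ n, 1 ≤ n → (ν 0 + 1 ≤ n ∨ eLpNorm (sumDensity P X n) ∞ volume < ∞) →
              densityDist P X n ≤ ENNReal.ofReal
                (C * varSum P X n ^ (-(3 / 2) : ℝ) * thirdMomentSum P X n)) := by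
  refine ⟨absoluteConstant, absoluteConstant_pos, ?_⟩
  intro Ω _ P _ X p ν lam s hX hind hp h3 h0 hB hO hν hlam hdens hs hslam hvar
  have hpos : ∀ n, 1 ≤ n → 0 < varSum P X n := fun n hn => varSum_pos hX hp h3 h0 hn
  obtain ⟨C, C₂, hC, hC₂, hev⟩ :=
    eventually_densityDist_le hX hind hp h3 h0 hB hO hν hlam hdens hs hvar
  have hmain : ∃ C₁ : ℝ, 0 < C₁ ∧
      ∀ n, (1 ≤ n ∧ (ν 0 + 1 ≤ n ∨ eLpNorm (sumDensity P X n) ∞ volume < ∞)) →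
        densityDist P X n ≤ ENNReal.ofReal
          (absoluteConstant * varSum P X n ^ (-(3 / 2) : ℝ) * thirdMomentSum P X n +
            C₁ * (√(varSum P X n) * Real.exp (-C₂ * (n : ℝ) ^ (lam - 2 * s)))) := by
    refine exists_forall_le_of_eventually_le hC (fun n hn => ?_) (fun n hn => ?_)
      (fun n hn => densityDist_lt_top_of_bounded hX hind hp h3 h0 hvar hn.1 hn.2) ?_
    · have := (hpos n hn.1).le
      have := thirdMomentSum_nonneg (P := P) (X := X) n
      have := absoluteConstant_pos
      positivity
    · have := Real.sqrt_pos.2 (hpos n hn.1)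
      positivity
    · simpa only [mul_assoc] using hev
  obtain ⟨C₁, hC₁, hle⟩ := hmain
  refine ⟨fun n hn => hasPDF_normalizedSum hX hind hp hn (hpos n hn), ⟨C₁, C₂, hC₁, hC₂, ?_⟩, ?_⟩
  · intro n hn hb
    simpa only [mul_assoc] using hle n ⟨hn, hb⟩
  · intro α hα hBα
    obtain ⟨A, hA, hAle⟩ := exists_sq_mul_exp_le hα hC₂ (by linarith : 0 < lam - 2 * s) hBα
    -- The third moments are bounded below by the first one, which is positive.
    set β := ∫ ω, |X 0 ω| ^ 3 ∂P with hβ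
    have hβ0 : 0 < β :=
      (pow_pos (Real.sqrt_pos.2 ((hp 0).variance_pos (hX 0) (h3 0) (h0 0))) 3).trans_le
        (sqrt_variance_pow_three_le (hX 0) (h3 0) (h0 0))
    have hβS : ∀ n, 1 ≤ n → β ≤ thirdMomentSum P X n := fun n hn =>
      Finset.single_le_sum (f := fun i => ∫ ω, |X i ω| ^ 3 ∂P)
        (fun i _ => integral_nonneg fun ω => by positivity) (Finset.mem_range.2 hn)
    refine ⟨absoluteConstant + C₁ * A / β,
      add_pos absoluteConstant_pos (by positivity), fun n hn hb => ?_⟩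
    refine (hle n ⟨hn, hb⟩).trans (ENNReal.ofReal_le_ofReal ?_)
    have hBn := hpos n hn
    rw [add_mul, add_mul]
    refine add_le_add le_rfl ?_
    have hsqrt : √(varSum P X n) = varSum P X n ^ (-(3 / 2) : ℝ) * varSum P X n ^ 2 := by
      rw [Real.sqrt_eq_rpow, ← Real.rpow_natCast, ← Real.rpow_add hBn]
      norm_num
    calc C₁ * (√(varSum P X n) * Real.exp (-C₂ * (n : ℝ) ^ (lam - 2 * s)))
        = C₁ * varSum P X n ^ (-(3 / 2) : ℝ)
          * (varSum P X n ^ 2 * Real.exp (-C₂ * (n : ℝ) ^ (lam - 2 * s))) := by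
          rw [hsqrt]
          ring
      _ ≤ C₁ * varSum P X n ^ (-(3 / 2) : ℝ) * A := by
          gcongr
          exact hAle n hn
      _ = C₁ * A / β * varSum P X n ^ (-(3 / 2) : ℝ) * β := by
          field_simp
      _ ≤ C₁ * A / β * varSum P X n ^ (-(3 / 2) : ℝ) * thirdMomentSum P X n := by
          gcongr
          exact hβS n hn
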